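/- Let $p$ be a prime and $G=\mathbb Z_{p^2}\oplus\mathbb Z_{p^2}$. For a subset $S=-S\subseteq G\setminus\{0\}$ let $\Gamma_G(S)$ be the Cayley graph of $G$ with connection set $S$. A strongly regular Cayley graph (SRCG) $\Gamma_G(S)$ is called trivial if $S\cup\{0\}$ or $G\setminus S$ is a subgroup of $G$. (Complete and edgeless graphs are counted as strongly regular; they are trivial.) Let $\Delta$ be the set of all cyclic subgroups of $G$; a member of order $p^i$ has length $i$. For $H\in\Delta$ let $O_H$ be the set of generators of $H$, and let $\mathrm{Sons}(H)$ be the set of all non-trivial $F\in\Delta$ with $pF=H$. A block is a non-empty set of the form $\mathrm{Sons}(H)$, $H\in\Delta$. The graph defined by $T\subseteq\Delta$ is $\Gamma_G\bigl(\bigcup_{H\in T}O_H\bigr)$. For integers $0\le a_1\le p+1$, $0\le a_2\le p-1$, a set $T\subseteq\Delta$ is $(a_1,a_2)$-homogeneous if $\{0\}\notin T$ and, for every $H\in\Delta$ of length $l\in\{0,1\}$, the number $|\mathrm{Sons}(H)\cap T|$ equals $a_{l+1}+1$ if $H\in T$, and $a_{l+1}$ if $H\notin T$. For $p=2$ let $\Gamma_2$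 be the family of the graphs defined by $T\cup B$, where $T$ is a $(2,0)$-homogeneous set and $B$ is the unique block of subgroups of length $2$ that is disjoint from $T$; let $\Gamma_2^c$ be the family of the complements of the graphs in $\Gamma_2$. The Clebsch graph is the strongly regular graph with parameters $(16,5,0,2)$ (the folded $5$-cube). Then for every non-trivial SRCG $\Gamma_G(S)$ over $G$ exactly one of the following holds: 1. $\Gamma_G(S)$ is defined by an $(a_1,a_2)$-homogeneous set for some $(a_1,a_2)\notin\{(1,0),(p,p-1),(0,0),(p+1,p-1)\}$; 2. $p=2$, and either $\Gamma_G(S)$ belongs to $\Gamma_2^c$ and is isomorphic to the Clebsch graph, or $\Gamma_G(S)$ belongs to $\Gamma_2$ and is isomorphic to the complement of the Clebsch graph. -/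

import Mathlib

open scoped Pointwise

namespace SRCG

/-- The group `ℤ_{p^n} ⊕ ℤ_{p^n}`, written additively. -/
abbrev Grp (p n : ℕ) : Type := ZMod (p ^ n) × ZMod (p ^ n)

section General

variable {G : Type*} [AddGroup G]

/-- The Cayley graph `Γ_G(S)` is strongly regular, for a connection set `S` that is symmetric and
does not contain the identity. Complete and edgeless graphs are allowed here; they are trivial in
the sense of `IsTrivial` below. -/
def IsSRCG [Fintype G] (S : Set G) : Prop :=
  open Classical in
  0 ∉ S ∧ -S = S ∧
    ∃ k l m : ℕ, (SimpleGraph.addCayley S).IsSRGWith (Fintype.card G) k l m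

/-- `S ∪ {e}` or `G \ S` is a subgroup of `G`. -/
def IsTrivial (S : Set G) : Prop :=
  ∃ K : AddSubgroup G, (K : Set G) = insert 0 S ∨ (K : Set G) = Sᶜ

/-- The set `Δ` of all cyclic subgroups. -/
def Delta (G : Type*) [AddGroup G] : Set (AddSubgroup G) := {H | IsAddCyclic H}

/-- The set `O_H` of all generators of `H`. -/
def gens (H : AddSubgroup G) : Set G := {g | AddSubgroup.zmultiples g = H}

/-- The graph `Γ_G(T)` defined by a set `T` of (cyclic) subgroups: the Cayley graph whose
connection set is the union of the sets `O_H`, `H ∈ T`. -/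
def graphOf (T : Set (AddSubgroup G)) : SimpleGraph G :=
  SimpleGraph.addCayley (⋃ H ∈ T, gens H)

end General

section Tree

variable {G : Type*} [AddCommGroup G]

/-- The father `pH = {p h | h ∈ H}` of `H`. -/
def father (p : ℕ) (H : AddSubgroup G) : AddSubgroup G := H.map (nsmulAddMonoidHom p)

/-- The sons of `H` in the tree `Δ`: the cyclic subgroups whose father is `H`. The root, which is
the trivial subgroup, is not a son of any node. -/
def sons (p : ℕ) (H : AddSubgroup G) : Set (AddSubgroup G) :=
  {F | F ∈ Delta G ∧ F ≠ ⊥ ∧ father p F = H}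

/-- A block of `Δ`: the set of all sons of a node which is not a leaf. -/
def IsBlock (p : ℕ) (B : Set (AddSubgroup G)) : Prop :=
  B.Nonempty ∧ ∃ H ∈ Delta G, B = sons p H

end Tree

/-- `T ⊆ Δ` is an `(a_1, …, a_n)`-homogeneous set; the coordinate `a_{i+1}` is `a i`, and a
subgroup of order `p ^ i` has length `i`. -/
def IsHomogeneous (p n : ℕ) (a : Fin n → ℕ) (T : Set (AddSubgroup (Grp p n))) : Prop :=
  open Classical in
  (∀ i : Fin n, a i ≤ if (i : ℕ) = 0 then p + 1 else p - 1) ∧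
  T ⊆ Delta (Grp p n) ∧ ⊥ ∉ T ∧
  ∀ H ∈ Delta (Grp p n), ∀ i : Fin n, Nat.card H = p ^ (i : ℕ) →
    (sons p H ∩ T).ncard = if H ∈ T then a i + 1 else a i

/-- The family of graphs defined by the union of a `(2, 0)`-homogeneous set `T` and a block `B`
that consists of subgroups of length `2` and is disjoint from `T`. The family `Γ_2` is the case
`p = 2`, in which `B` is determined by `T`. -/
def Gamma2 (p : ℕ) : Set (SimpleGraph (Grp p 2)) :=
  {Γ | ∃ T B : Set (AddSubgroup (Grp p 2)),
    IsHomogeneous p 2 ![2, 0] T ∧ IsBlock p B ∧ (∀ H ∈ B, Nat.card H = p ^ 2) ∧ Disjoint B T ∧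
    Γ = graphOf (T ∪ B)}

/-- The family `Γ_2^c` of the complements. -/
def Gamma2c (p : ℕ) : Set (SimpleGraph (Grp p 2)) := {Γ | Γᶜ ∈ Gamma2 p}

/-- The Clebsch graph, the strongly regular graph with parameters `(16, 5, 0, 2)`, as the folded
`5`-cube: the vertices are the binary words of length `4`, and two of them are adjacent if they
differ in exactly one position or in all four. -/
def clebsch : SimpleGraph (Fin 4 → Bool) :=
  SimpleGraph.fromRel fun x y => hammingDist x y = 1 ∨ hammingDist x y = 4

end SRCG

namespace SRCG

/-! ### Eigenvalues as character sums, integrality, and stability under units. -/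

section CharacterSums

variable {G : Type*} [AddCommGroup G]

/-! The eigenvalues of a Cayley graph on an abelian group are the character sums of its connection
set, and for a strongly regular graph those of nontrivial characters are roots of one quadratic.
Since `|G| = (p ^ 2) ^ 2` is a square, irrational roots would force conference graph parameters with
discriminant `|G|`, which is absurd; so all sums are integers (`exists_int_charSum`). Galois
conjugation of roots of unity then makes `S` stable under multiplication by integers prime to `p`
(`nsmul_mem_of_int_charSum`), so `S` is a union of generator sets of cyclic subgroups, collected in
a set `T`.

For a subgroup `H` of order `p` let `t H` be 1 or 0 according to membership in `T`, and let `s H`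
count the sons of `H` in `T`. After the same affine normalisation, characters of order `p ^ 2` have
eigenvalues `t H - s H` or `t H - s H + p`, and characters of order `p` have `∑ t - ∑ s + p * s H`.
At most two values may occur, and `classification` solves this purely numerical problem. Its
solutions are: `s - t` constant, which is homogeneity; two exceptional patterns for `p = 2`; and
patterns that describe a proper subgroup or the complement of one, which give trivial graphs
(`homogeneous_or_exceptional`). The excluded homogeneous parameters are trivial as well
(`isTrivial_of_homogeneous`).

The two exceptional patterns are complementary to each other, and a Gray code identifies one graph
of each complementary pair with the Clebsch graph (`IsExceptional.nonempty_iso`). The alternatives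
exclude each other by valency: a homogeneous set for `p = 2` gives a multiple of 3
(`three_dvd_ncard_connSet`), whereas the Clebsch graph and its complement have valencies 5 and 10.
-/

lemma addCayley_adj_iff {S : Set G} (h0 : 0 ∉ S) (hneg : -S = S) (x y : G) :
    (SimpleGraph.addCayley S).Adj x y ↔ y - x ∈ S := by
  have hn : ∀ z, z ∈ S ↔ -z ∈ S := fun z => by
    conv_lhs => rw [← hneg]
    exact Set.mem_neg
  rw [SimpleGraph.addCayley_adj, hn (-y + x)]
  have e1 : -x + y = y - x := by abel
  have e2 : -(-y + x) = y - x := by abel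
  rw [e1, e2, or_self]
  constructor
  · exact fun h => h.2
  · refine fun h => ⟨?_, h⟩
    rintro rfl
    exact h0 (by simpa using h)

variable [Fintype G]

open Classical in
/-- The character sum of a subset of a finite abelian group. -/
noncomputable def charSum (S : Set G) (χ : AddChar G ℂ) : ℂ := ∑ x with x ∈ S, χ x

-- A character is an eigenvector of the adjacency matrix `A` with its character sum as eigenvalue.
-- Applying `A² = k I + l A + m (J - I - A)` to it and reading off the coordinate at `0` gives the
-- relation.
open Classical in
lemma charSum_sq {S : Set G} (hS : IsSRCG S) :
    ∃ k l m : ℕ, k = S.ncard ∧ ∀ χ : AddChar G ℂ,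
      charSum S χ ^ 2 = k + l * charSum S χ + m * (∑ x, χ x - 1 - charSum S χ) := by
  obtain ⟨h0, hneg, k, l, m, h⟩ := hS
  obtain ⟨Γ, _, h, hadj⟩ : ∃ (Γ : SimpleGraph G) (_ : DecidableRel Γ.Adj),
      Γ.IsSRGWith (Fintype.card G) k l m ∧ ∀ x y, Γ.Adj x y ↔ y - x ∈ S :=
    ⟨_, _, h, addCayley_adj_iff h0 hneg⟩
  have hA : ∀ (χ : AddChar G ℂ) (x : G),
      (Γ.adjMatrix ℂ).mulVec (fun y => χ y) x = charSum S χ * χ x := by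
    intro χ x
    rw [SimpleGraph.adjMatrix_mulVec_apply, charSum, Finset.sum_mul]
    refine Finset.sum_bij' (fun y _ => y - x) (fun y _ => y + x) ?_ ?_ ?_ ?_ ?_
    · intro y hy
      simpa [hadj] using hy
    · intro y hy
      simpa [hadj] using hy
    · simp
    · simp
    · intro y _
      rw [← AddChar.map_add_eq_mul]; simp
  refine ⟨k, l, m, ?_, fun χ => ?_⟩
  · have h1 := h.regular 0
    rw [SimpleGraph.degree] at h1
    rw [← h1, Set.ncard_eq_toFinset_card']
    congr 1
    ext y
    simp [hadj]
  · have h1 := h.matrix_eq (α := ℂ)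
    have h2 := congrFun (congrArg (fun M => M.mulVec (fun y => χ y)) h1) 0
    have h3 : (Γᶜ.adjMatrix ℂ).mulVec (fun y => χ y) 0 = ∑ x, χ x - 1 - charSum S χ := by
      have h4 := Γ.one_add_adjMatrix_add_compl_adjMatrix_eq_of_one (α := ℂ)
      have h5 := congrFun (congrArg (fun M => M.mulVec (fun y => χ y)) h4) 0
      simp only [Matrix.add_mulVec, Matrix.one_mulVec, Pi.add_apply, hA] at h5
      have h6 : (Matrix.of (1 : G → G → ℂ)).mulVec (fun y => χ y) 0 = ∑ x, χ x := by
        simp [Matrix.mulVec, dotProduct]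
      rw [h6] at h5
      rw [SimpleGraph.compl_adjMatrix_eq_adjMatrix_compl] at h5
      simp only [AddChar.map_zero_eq_one] at h5
      linear_combination h5
    simp only [pow_two, ← Matrix.mulVec_mulVec, Matrix.add_mulVec, Matrix.smul_mulVec,
      Matrix.one_mulVec, Pi.add_apply, Pi.smul_apply] at h2
    have h4 : (Γ.adjMatrix ℂ).mulVec ((Γ.adjMatrix ℂ).mulVec (fun y => χ y)) 0
        = charSum S χ * charSum S χ := by
      have : (Γ.adjMatrix ℂ).mulVec (fun y => χ y) = charSum S χ • (fun y => χ y) := by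
        ext x; simp [hA]
      rw [this, Matrix.mulVec_smul, Pi.smul_apply, hA]; simp
    rw [h4, hA, h3] at h2
    simp only [AddChar.map_zero_eq_one] at h2
    rw [pow_two, h2]
    simp only [nsmul_eq_mul]
    ring

lemma charSum_zero (S : Set G) : charSum S 0 = S.ncard := by
  classical
  rw [charSum, Set.ncard_eq_toFinset_card']
  simp [Set.toFinset]

lemma charSum_quadratic {S : Set G} (hS : IsSRCG S) :
    ∃ l m : ℕ, (S.ncard : ℤ) ^ 2 = S.ncard + l * S.ncard + m * (Fintype.card G - 1 - S.ncard) ∧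
      ∀ χ : AddChar G ℂ, χ ≠ 0 → charSum S χ ^ 2 =
        ((S.ncard : ℤ) - m : ℤ) + ((l : ℤ) - m : ℤ) * charSum S χ := by
  obtain ⟨k, l, m, rfl, h⟩ := charSum_sq hS
  refine ⟨l, m, ?_, fun χ hχ => ?_⟩
  · have := h 0
    rw [charSum_zero] at this
    simp at this
    exact_mod_cast this
  · rw [h χ, AddChar.sum_eq_zero_iff_ne_zero.2 hχ]
    push_cast; ring

open Classical in
lemma sum_charSum {S : Set G} (h0 : 0 ∉ S) : ∑ χ : AddChar G ℂ, charSum S χ = 0 := by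
  simp only [charSum]
  rw [Finset.sum_comm]
  refine Finset.sum_eq_zero fun x hx => ?_
  rw [AddChar.sum_apply_eq_ite, if_neg]
  rintro rfl
  exact h0 (by simpa using hx)

open Classical in
/-- A subset is determined by its character sums. -/
lemma eq_of_charSum_eq {S S' : Set G} (h : ∀ χ, charSum S χ = charSum S' χ) : S = S' := by
  have key : ∀ (S : Set G) (a : G), ∑ χ : AddChar G ℂ, χ (-a) * charSum S χ
      = if a ∈ S then (Fintype.card G : ℂ) else 0 := by
    intro S a
    simp only [charSum, Finset.mul_sum]
    rw [Finset.sum_comm]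
    have : ∀ x, ∑ χ : AddChar G ℂ, χ (-a) * χ x = if x = a then (Fintype.card G : ℂ) else 0 := by
      intro x
      simp only [← AddChar.map_add_eq_mul]
      rw [AddChar.sum_apply_eq_ite]
      congr 1
      rw [neg_add_eq_zero, eq_comm (a := x)]
    simp only [this]
    simp
  ext a
  have h1 := key S a
  simp only [h] at h1
  rw [key S' a] at h1
  have hc : (Fintype.card G : ℂ) ≠ 0 := Nat.cast_ne_zero.2 Fintype.card_ne_zero
  by_cases ha : a ∈ S <;> by_cases hb : a ∈ S' <;> simp_all

lemma isTrivial_of_ncard_eq_zero {S : Set G} (h : S.ncard = 0) : IsTrivial S := by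
  refine ⟨⊤, Or.inr ?_⟩
  rw [Set.ncard_eq_zero] at h
  simp [h]

lemma isTrivial_of_ncard_add_one {S : Set G} (h0 : 0 ∉ S) (h : S.ncard + 1 = Fintype.card G) :
    IsTrivial S := by
  refine ⟨⊤, Or.inl ?_⟩
  rw [← Set.ncard_insert_of_notMem h0, ← Nat.card_eq_fintype_card] at h
  rw [(Set.eq_univ_iff_ncard _).2 h]; rfl

/-- If the order of the group is a square then the eigenvalues of a nontrivial strongly regular
Cayley graph are integers. -/
theorem exists_int_charSum {S : Set G} (hS : IsSRCG S) (hT : ¬ IsTrivial S) {N : ℕ}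
    (hN : Fintype.card G = N ^ 2) :
    (∀ χ : AddChar G ℂ, ∃ z : ℤ, charSum S χ = z) := by
  classical
  obtain ⟨l, m, hk, hq⟩ := charSum_quadratic hS
  set k : ℤ := (S.ncard : ℤ) with hkdef
  set D : ℤ := ((l : ℤ) - m) ^ 2 + 4 * (k - m) with hD
  have hsq : ∀ χ : AddChar G ℂ, χ ≠ 0 → (2 * charSum S χ - ((l : ℤ) - m : ℤ)) ^ 2 = (D : ℂ) := by
    intro χ hχ
    have := hq χ hχ
    push_cast [hD] at this ⊢
    linear_combination 4 * this
  have hkn : k ≠ 0 := by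
    intro h
    exact hT (isTrivial_of_ncard_eq_zero (by simpa [k] using h))
  have hkn1 : k ≠ Fintype.card G - 1 := by
    intro h
    apply hT (isTrivial_of_ncard_add_one hS.1 _)
    omega
  have hle : S.ncard ≤ Fintype.card G := by
    rw [← Nat.card_eq_fintype_card, ← Set.ncard_univ]
    exact Set.ncard_le_ncard (Set.subset_univ S)
  have hD2 : ∃ r : ℤ, D = r ^ 2 := by
    -- With `d² = D` not a square, every nontrivial eigenvalue `θ` has `2θ - (l - m) = ±d`. The sum
    -- of these is an integer `b = a d`, so irrationality gives `a = b = 0`.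
    by_contra hns
    obtain ⟨d, hd⟩ : ∃ d : ℂ, d ^ 2 = (D : ℂ) := IsAlgClosed.exists_pow_nat_eq _ (by norm_num)
    have hsign : ∀ χ : AddChar G ℂ, ∃ e : ℤ, χ ≠ 0 →
        2 * charSum S χ - ((l : ℤ) - m : ℤ) = e * d := by
      intro χ
      by_cases hχ : χ = 0
      · exact ⟨0, fun h => absurd hχ h⟩
      · have h1 := hsq χ hχ
        rw [← hd] at h1
        rcases sq_eq_sq_iff_eq_or_eq_neg.1 h1 with h | h
        · exact ⟨1, fun _ => by rw [h]; simp⟩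
        · exact ⟨-1, fun _ => by rw [h]; simp⟩
    choose e he using hsign
    have hsum : ∑ χ ∈ Finset.univ.erase (0 : AddChar G ℂ), (2 * charSum S χ - ((l : ℤ) - m : ℤ))
        = ((-2 * k - (Fintype.card G - 1) * (l - m) : ℤ) : ℂ) := by
      rw [Finset.sum_sub_distrib, ← Finset.mul_sum]
      have h1 := Finset.add_sum_erase Finset.univ (fun χ => charSum S χ)
        (Finset.mem_univ (0 : AddChar G ℂ))
      rw [sum_charSum hS.1, charSum_zero] at h1
      have h2 : (∑ χ ∈ Finset.univ.erase (0 : AddChar G ℂ), charSum S χ) = -(S.ncard : ℂ) := by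
        linear_combination h1
      rw [h2, Finset.sum_const, Finset.card_erase_of_mem (Finset.mem_univ _), Finset.card_univ,
        AddChar.card_eq, nsmul_eq_mul, Nat.cast_sub Fintype.card_pos]
      push_cast [hkdef]
      ring
    rw [Finset.sum_congr rfl (fun χ hχ => he χ (Finset.ne_of_mem_erase hχ)), ← Finset.sum_mul,
      ← Int.cast_sum] at hsum
    set a : ℤ := ∑ χ ∈ Finset.univ.erase (0 : AddChar G ℂ), e χ
    set b : ℤ := -2 * k - (Fintype.card G - 1) * (l - m) with hb
    have hab : a ^ 2 * D = b ^ 2 := by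
      have : ((a : ℂ) * d) ^ 2 = (b : ℂ) ^ 2 := by rw [hsum]
      rw [mul_pow, hd] at this
      exact_mod_cast this
    have ha : a = 0 := by
      by_contra ha
      apply hns
      have hdvd : a ∣ b := by
        rw [← Int.pow_dvd_pow_iff two_ne_zero]
        exact ⟨D, hab.symm⟩
      obtain ⟨r, hr⟩ := hdvd
      refine ⟨r, ?_⟩
      rw [hr, mul_pow] at hab
      exact mul_left_cancel₀ (pow_ne_zero 2 ha) hab
    have hb0 : b = 0 := by
      rw [ha] at hab
      simpa using hab.symm
    have hkG : S.ncard < Fintype.card G := lt_of_le_of_ne hle fun h => by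
      have := (Set.eq_univ_iff_ncard S).2 (by rw [h, Nat.card_eq_fintype_card])
      exact hS.1 (this ▸ Set.mem_univ 0)
    have hn : (0:ℤ) < (Fintype.card G - 1) := by simp only [k] at hkn; omega
    -- Now `2k = (|G| - 1)(m - l)` with `0 < k < |G| - 1`. It follows that `m - l = 1` and `k = 2m`,
    -- whence `D = 1 + 4m = |G| = N²`, a contradiction.
    have h1 : ((m : ℤ) - l) = 1 := by
      have h2 : 2 * k = (Fintype.card G - 1) * ((m:ℤ) - l) := by
        rw [hb0] at hb; linarith
      have h3 : 0 < k := by simp only [k] at hkn ⊢; omega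
      have h4 : k < Fintype.card G - 1 := by simp only [k] at hkn1 h2 ⊢; omega
      have h5 : 0 < ((m : ℤ) - l) := by
        by_contra hc
        nlinarith
      have h6 : ((m : ℤ) - l) < 2 := by
        by_contra hc
        nlinarith
      omega
    have h2 : 2 * k = Fintype.card G - 1 := by
      have : -2 * k - (Fintype.card G - 1) * ((l:ℤ) - m) = 0 := by rw [← hb, hb0]
      have hlm : (l:ℤ) - m = -1 := by omega
      rw [hlm] at this
      linarith
    have h3 : k = 2 * m := by
      have hlm : (l:ℤ) = m - 1 := by omega
      rw [hlm] at hk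
      have : k * (k - 2 * m) = 0 := by
        linear_combination hk - (m : ℤ) * h2
      rcases mul_eq_zero.1 this with h | h
      · exact absurd h hkn
      · linarith
    apply hns
    refine ⟨N, ?_⟩
    have hNZ : (Fintype.card G : ℤ) = (N:ℤ) ^ 2 := by exact_mod_cast hN
    rw [← hNZ, hD]
    have hlm : (l:ℤ) - m = -1 := by omega
    rw [hlm]
    linarith
  obtain ⟨r, hr⟩ := hD2
  intro χ
  by_cases hχ : χ = 0
  · exact ⟨S.ncard, by rw [hχ, charSum_zero]; simp⟩
  · have h1 := hsq χ hχ
    -- `D` and `(l - m)²` agree modulo 4, so halving in the quadratic formula stays within the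
    -- integers.
    have hpar : ∀ s : ℤ, s ^ 2 = D → ∃ z : ℤ, s + ((l:ℤ) - m) = 2 * z := by
      intro s hs
      have h2 : (2:ℤ) ∣ (s - (l - m)) * (s + (l - m)) := ⟨2 * (k - m), by rw [hD] at hs; linarith⟩
      rcases Int.prime_two.dvd_or_dvd h2 with h | h
      · obtain ⟨z, hz⟩ := h
        exact ⟨z + (l - m), by linarith⟩
      · exact h
    rw [hr] at h1
    push_cast at h1
    rcases sq_eq_sq_iff_eq_or_eq_neg.1 h1 with h | h
    · obtain ⟨z, hz⟩ := hpar r hr.symm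
      refine ⟨z, ?_⟩
      have hz' : (r : ℂ) + ((l:ℂ) - m) = 2 * z := by exact_mod_cast hz
      linear_combination h / 2 + hz' / 2
    · obtain ⟨z, hz⟩ := hpar (-r) (by rw [hr]; ring)
      refine ⟨z, ?_⟩
      have hz' : -(r : ℂ) + ((l:ℂ) - m) = 2 * z := by exact_mod_cast hz
      linear_combination h / 2 + hz' / 2

open Classical in
/-- Integrality of the character sums of `S` forces `S` to be stable under multiplication by
integers prime to the exponent. -/
theorem nsmul_mem_of_int_charSum {S : Set G} {N : ℕ} (hN : 0 < N) (hexp : ∀ x : G, N • x = 0)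
    (hint : ∀ χ : AddChar G ℂ, ∃ z : ℤ, charSum S χ = z) {t : ℕ} (ht : t.Coprime N) {x : G}
    (hx : x ∈ S) : t • x ∈ S := by
  have hζ := Complex.isPrimitiveRoot_exp N hN.ne'
  set ζ := Complex.exp (2 * Real.pi * Complex.I / N)
  have hinj : Function.Injective (fun x : G => t • x) := by
    intro x y hxy
    have h1 : addOrderOf (x - y) ∣ t :=
      addOrderOf_dvd_of_nsmul_eq_zero (by rw [nsmul_sub, sub_eq_zero]; exact hxy)
    have h2 : addOrderOf (x - y) ∣ N := addOrderOf_dvd_of_nsmul_eq_zero (hexp _)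
    have h3 := Nat.dvd_gcd h1 h2
    rw [ht.gcd_eq_one, Nat.dvd_one, AddMonoid.addOrderOf_eq_one_iff, sub_eq_zero] at h3
    exact h3
  have hsum : ∀ χ : AddChar G ℂ, charSum S χ = charSum ((fun x : G => t • x) '' S) χ := by
    intro χ
    have h1 : charSum ((fun x : G => t • x) '' S) χ = ∑ x with x ∈ S, (χ x) ^ t := by
      rw [charSum]
      symm
      refine Finset.sum_bij (fun x _ => t • x) ?_ ?_ ?_ ?_
      · intro y hy
        simp only [Finset.mem_filter, Finset.mem_univ, true_and] at hy ⊢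
        exact ⟨y, hy, rfl⟩
      · intro a _ b _ h
        exact hinj h
      · intro y hy
        simp only [Finset.mem_filter, Finset.mem_univ, true_and] at hy
        obtain ⟨z, hz, rfl⟩ := hy
        exact ⟨z, by simpa using hz, rfl⟩
      · intro y _
        rw [AddChar.map_nsmul_eq_pow]
    have hroot : ∀ y : G, ∃ i : ℕ, ζ ^ i = χ y := by
      intro y
      have : NeZero N := ⟨hN.ne'⟩
      obtain ⟨i, _, hi⟩ := hζ.eq_pow_of_pow_eq_one (ξ := χ y)
        (by rw [← AddChar.map_nsmul_eq_pow, hexp, AddChar.map_zero_eq_one])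
      exact ⟨i, hi⟩
    choose i hi using hroot
    obtain ⟨z, hz⟩ := hint χ
    -- `Q` vanishes at `ζ` because the character sum equals `z`. The conjugate `ζ ^ t` has the same
    -- minimal polynomial, so `Q` vanishes there too, which says that the image of `S` under `t` has
    -- the same sum `z`.
    let Q : Polynomial ℤ := ∑ y with y ∈ S, Polynomial.X ^ (i y) - Polynomial.C z
    have hQ : Polynomial.aeval ζ Q = 0 := by
      simp only [Q, map_sub, map_sum, map_pow, Polynomial.aeval_X, Polynomial.aeval_C, hi]
      rw [← charSum, hz]; simp
    have hQt : Polynomial.aeval (ζ ^ t) Q = 0 := by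
      have hd : minpoly ℤ ζ ∣ Q := minpoly.isIntegrallyClosed_dvd (hζ.isIntegral hN) hQ
      rw [hζ.minpoly_eq_pow_coprime ht] at hd
      obtain ⟨R, hR⟩ := hd
      rw [hR, map_mul, minpoly.aeval, zero_mul]
    simp only [Q, map_sub, map_sum, map_pow, Polynomial.aeval_X, Polynomial.aeval_C] at hQt
    rw [h1, hz]
    have h2 : ∀ y, (ζ ^ t) ^ i y = χ y ^ t := by
      intro y; rw [← hi y, ← pow_mul, ← pow_mul, mul_comm]
    simp only [h2] at hQt
    have h3 := sub_eq_zero.1 hQt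
    rw [h3]; simp
  rw [eq_of_charSum_eq hsum]
  exact ⟨x, hx, rfl⟩

end CharacterSums

open AddSubgroup

/-! ### Cyclic subgroups in exponent `p ^ 2` and the character sums of their generators. -/

section Cyclic

variable {G : Type*} [AddCommGroup G] {p : ℕ} [Fact p.Prime]

lemma mem_delta_iff {H : AddSubgroup G} : H ∈ Delta G ↔ ∃ x, H = zmultiples x := by
  rw [Delta, Set.mem_ofPred_eq, AddSubgroup.isAddCyclic_iff_exists_zmultiples_eq_top]
  simp only [eq_comm]

lemma zmultiples_mem_delta (x : G) : zmultiples x ∈ Delta G := mem_delta_iff.2 ⟨x, rfl⟩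

lemma mem_gens {H : AddSubgroup G} {x : G} : x ∈ gens H ↔ zmultiples x = H := Iff.rfl

lemma father_zmultiples (p : ℕ) (x : G) : father p (zmultiples x) = zmultiples (p • x) := by
  rw [father, AddMonoidHom.map_zmultiples]; rfl

/-- An element of a cyclic group of exponent dividing `p ^ 2` is a generator or a multiple of
`p`. -/
lemma mem_zmultiples_nsmul_or_eq (hexp : ∀ x : G, (p ^ 2) • x = 0) {x v : G}
    (h : x ∈ zmultiples v) : x ∈ zmultiples (p • v) ∨ zmultiples x = zmultiples v := by
  obtain ⟨a, rfl⟩ := mem_zmultiples_iff.1 h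
  by_cases hp : (p : ℤ) ∣ a
  · left
    obtain ⟨b, rfl⟩ := hp
    exact mem_zmultiples_iff.2 ⟨b, by rw [mul_comm, mul_smul, natCast_zsmul]⟩
  · right
    have hp' := (Nat.prime_iff_prime_int.1 (Fact.out : p.Prime))
    have hc : IsCoprime a ((p : ℤ) ^ 2) :=
      (((Prime.coprime_iff_not_dvd hp').2 hp).symm).pow_right
    obtain ⟨u, w, huw⟩ := hc
    refine le_antisymm (zmultiples_le_of_mem h) (zmultiples_le_of_mem ?_)
    refine mem_zmultiples_iff.2 ⟨u, ?_⟩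
    have h1 : ((p : ℤ) ^ 2) • v = 0 := by exact_mod_cast hexp v
    rw [← mul_smul]
    conv_rhs => rw [← one_smul ℤ v, ← huw, add_smul, mul_smul w, h1, smul_zero, add_zero]

lemma zmultiples_eq_of_mem (hexp : ∀ x : G, (p ^ 2) • x = 0) {x y : G} (hx : x ≠ 0)
    (hy : p • y = 0) (h : x ∈ zmultiples y) : zmultiples x = zmultiples y := by
  rcases mem_zmultiples_nsmul_or_eq hexp h with h | h
  · rw [hy] at h
    exact absurd (by simpa using h) hx
  · exact h

lemma nsmul_eq_zero_of_mem {x y : G} (n : ℕ) (hy : n • y = 0) (h : x ∈ zmultiples y) :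
    n • x = 0 := by
  obtain ⟨a, rfl⟩ := mem_zmultiples_iff.1 h
  rw [smul_comm, hy, smul_zero]

lemma nsmul_mem_zmultiples_nsmul {x y : G} (n : ℕ) (h : x ∈ zmultiples y) :
    n • x ∈ zmultiples (n • y) := by
  obtain ⟨a, rfl⟩ := mem_zmultiples_iff.1 h
  exact mem_zmultiples_iff.2 ⟨a, smul_comm _ _ _⟩

lemma mem_zmultiples_nsmul_of_mem (hexp : ∀ x : G, (p ^ 2) • x = 0) {x v : G} (hx : p • x = 0)
    (hv : p • v ≠ 0) (h : x ∈ zmultiples v) : x ∈ zmultiples (p • v) := by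
  rcases mem_zmultiples_nsmul_or_eq hexp h with h | h
  · exact h
  · exact absurd (nsmul_eq_zero_of_mem p hx (h ▸ mem_zmultiples v)) hv

lemma zmultiples_eq_of_mem' (hexp : ∀ x : G, (p ^ 2) • x = 0) {x v : G} (hx : p • x ≠ 0)
    (h : x ∈ zmultiples v) : zmultiples x = zmultiples v := by
  rcases mem_zmultiples_nsmul_or_eq hexp h with h | h
  · refine absurd (nsmul_eq_zero_of_mem p ?_ h) hx
    rw [← mul_smul, ← pow_two, hexp]
  · exact h

omit [Fact p.Prime] in
lemma nsmul_nsmul_eq_zero (hexp : ∀ x : G, (p ^ 2) • x = 0) (x : G) : p • p • x = 0 := by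
  rw [← mul_smul, ← pow_two, hexp]

/-- The generators of a nontrivial cyclic `p`-group are the elements that are not multiples of
`p`. -/
lemma gens_zmultiples (hexp : ∀ x : G, (p ^ 2) • x = 0) {x : G} (hx : x ≠ 0) :
    gens (zmultiples x) = (zmultiples x : Set G) \ zmultiples (p • x) := by
  ext y
  simp only [gens, Set.mem_ofPred_eq, Set.mem_sdiff, SetLike.mem_coe]
  constructor
  · intro h
    refine ⟨h ▸ mem_zmultiples y, fun h2 => hx ?_⟩
    have hxy : x ∈ zmultiples y := h ▸ mem_zmultiples x
    have h4 : x ∈ zmultiples (p • x) := zmultiples_le_of_mem h2 hxy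
    have h3 : p • x = 0 := nsmul_eq_zero_of_mem p (nsmul_nsmul_eq_zero hexp x) h4
    rw [h3] at h4
    simpa using h4
  · rintro ⟨h1, h2⟩
    exact (mem_zmultiples_nsmul_or_eq hexp h1).resolve_left h2

lemma addOrderOf_of_nsmul_eq_zero {x : G} (hx : x ≠ 0) (h : p • x = 0) : addOrderOf x = p :=
  addOrderOf_eq_prime h hx

lemma addOrderOf_of_nsmul_ne_zero (hexp : ∀ x : G, (p ^ 2) • x = 0) {x : G} (h : p • x ≠ 0) :
    addOrderOf x = p ^ 2 :=
  addOrderOf_eq_prime_pow (n := 1) (by rwa [pow_one]) (hexp x)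

variable [Fintype G]

open Classical in
lemma charSum_subgroup (K : AddSubgroup G) (χ : AddChar G ℂ) :
    charSum (K : Set G) χ = if ∀ x ∈ K, χ x = 1 then (Nat.card K : ℂ) else 0 := by
  have h1 : charSum (K : Set G) χ = ∑ x : K, (χ.compAddMonoidHom K.subtype) x := by
    rw [charSum, ← Finset.sum_subtype_eq_sum_filter]
    refine Finset.sum_bij' (fun x _ => ⟨x.1, by simp⟩) (fun x _ => ⟨x.1, by simp⟩)
      ?_ ?_ ?_ ?_ ?_ <;> simp
  rw [h1, AddChar.sum_eq_ite, Nat.card_eq_fintype_card]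
  congr 1
  rw [AddChar.eq_zero_iff]
  simp

open Classical in
lemma charSum_zmultiples (x : G) (χ : AddChar G ℂ) :
    charSum (zmultiples x : Set G) χ = if χ x = 1 then (addOrderOf x : ℂ) else 0 := by
  rw [charSum_subgroup, Nat.card_zmultiples]
  congr 1
  simp only [eq_iff_iff]
  refine ⟨fun h => h x (mem_zmultiples x), fun h y hy => ?_⟩
  obtain ⟨a, rfl⟩ := mem_zmultiples_iff.1 hy
  rw [AddChar.map_zsmul_eq_zpow, h, one_zpow]

-- The generators form the difference of two nested cyclic subgroups, and a character sums over a
-- subgroup to its order or to zero.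
open Classical in
lemma charSum_gens (hexp : ∀ x : G, (p ^ 2) • x = 0) {x : G} (hx : x ≠ 0) (χ : AddChar G ℂ) :
    charSum (gens (zmultiples x)) χ = (if χ x = 1 then (addOrderOf x : ℂ) else 0) -
      if χ (p • x) = 1 then (addOrderOf (p • x) : ℂ) else 0 := by
  rw [← charSum_zmultiples, ← charSum_zmultiples, gens_zmultiples hexp hx]
  rw [eq_sub_iff_add_eq]
  simp only [charSum]
  rw [← Finset.sum_union]
  · congr 1
    ext y
    simp only [Finset.mem_union, Finset.mem_filter, Finset.mem_univ, true_and, Set.mem_sdiff]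
    have : y ∈ (zmultiples (p • x) : Set G) → y ∈ (zmultiples x : Set G) :=
      fun h => zmultiples_le_of_mem (nsmul_mem (mem_zmultiples x) p) h
    tauto
  · rw [Finset.disjoint_left]
    intro y hy
    simp only [Finset.mem_filter, Finset.mem_univ, true_and, Set.mem_sdiff] at hy ⊢
    exact hy.2

/-- The union of the sets of generators of the members of `T`. -/
def connSet (T : Set (AddSubgroup G)) : Set G := ⋃ H ∈ T, gens H

omit [Fintype G] in
lemma mem_connSet {T : Set (AddSubgroup G)} {x : G} : x ∈ connSet T ↔ zmultiples x ∈ T := by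
  simp [connSet, mem_gens]

open Classical in
lemma charSum_connSet (T : Set (AddSubgroup G)) (χ : AddChar G ℂ) :
    charSum (connSet T) χ = ∑ H with H ∈ T, charSum (gens H) χ := by
  simp only [charSum]
  rw [← Finset.sum_biUnion]
  · congr 1
    ext x
    simp [mem_connSet, mem_gens]
  · intro H _ K _ hHK
    rw [Function.onFun, Finset.disjoint_left]
    intro y hy hy'
    simp only [Finset.mem_filter, Finset.mem_univ, true_and, mem_gens] at hy hy'
    exact hHK (hy.symm.trans hy')

end Cyclic

/-! ### Eigenvalues in terms of the tree of cyclic subgroups. -/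

section Eigenvalues

variable {G : Type*} [AddCommGroup G] {p : ℕ} [Fact p.Prime]

omit [Fact p.Prime] in
lemma mem_sons_bot {H : AddSubgroup G} :
    H ∈ sons p (⊥ : AddSubgroup G) ↔ ∃ x : G, x ≠ 0 ∧ p • x = 0 ∧ H = zmultiples x := by
  constructor
  · rintro ⟨hH, hne, hf⟩
    obtain ⟨x, rfl⟩ := mem_delta_iff.1 hH
    rw [father_zmultiples, zmultiples_eq_bot] at hf
    exact ⟨x, fun h => hne (by rw [h, zmultiples_zero_eq_bot]), hf, rfl⟩
  · rintro ⟨x, hx, hp, rfl⟩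
    exact ⟨zmultiples_mem_delta x, by simpa using hx, by rw [father_zmultiples, hp]; simp⟩

omit [Fact p.Prime] in
lemma mem_sons_zmultiples {F : AddSubgroup G} {y : G} (hy : y ≠ 0) :
    F ∈ sons p (zmultiples y) ↔
      ∃ x : G, p • x ≠ 0 ∧ zmultiples (p • x) = zmultiples y ∧ F = zmultiples x := by
  constructor
  · rintro ⟨hF, hne, hf⟩
    obtain ⟨x, rfl⟩ := mem_delta_iff.1 hF
    rw [father_zmultiples] at hf
    refine ⟨x, fun h => hy ?_, hf, rfl⟩
    rw [h] at hf
    simpa using hf.symm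
  · rintro ⟨x, hx, hp, rfl⟩
    refine ⟨zmultiples_mem_delta x, ?_, by rw [father_zmultiples, hp]⟩
    rw [Ne, zmultiples_eq_bot]
    rintro rfl
    simp at hx

variable [Fintype G]

open Classical in
/-- The character sum of the connection set of `T`, for a character whose values on the cyclic
subgroups of order `p` and `p ^ 2` are described by `A` and `B`. -/
lemma charSum_connSet_eq (hexp : ∀ x : G, (p ^ 2) • x = 0) {T : Set (AddSubgroup G)}
    (hT : T ⊆ Delta G) (hbot : ⊥ ∉ T) {χ : AddChar G ℂ} {A B : Set (AddSubgroup G)}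
    (hA : ∀ x : G, x ≠ 0 → p • x = 0 → (χ x = 1 ↔ zmultiples x ∈ A))
    (hB : ∀ x : G, p • x ≠ 0 → (χ x = 1 ↔ zmultiples x ∈ B)) :
    charSum (connSet T) χ = ((p * (sons p ⊥ ∩ T ∩ A).ncard - (sons p ⊥ ∩ T).ncard +
      p ^ 2 * ((T \ sons p ⊥) ∩ B).ncard -
      p * ((T \ sons p ⊥) ∩ {F | father p F ∈ A}).ncard : ℤ) : ℂ) := by
  have hne : ∀ x, zmultiples x ∈ T → x ≠ 0 := by
    rintro x hx rfl
    exact hbot (by simpa using hx)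
  -- A subgroup of order `p` loses its identity element, whence `-1`; one of order `p ^ 2` loses its
  -- father, which counts only when the character is trivial on it.
  have key : ∀ H ∈ T, charSum (gens H) χ =
      (if H ∈ sons p ⊥ then (if H ∈ A then (p : ℂ) else 0) - 1 else
        (if H ∈ B then (p : ℂ) ^ 2 else 0) - if father p H ∈ A then (p : ℂ) else 0) := by
    intro H hH
    obtain ⟨x, rfl⟩ := mem_delta_iff.1 (hT hH)
    have hx := hne x hH
    rw [charSum_gens hexp hx]
    by_cases hpx : p • x = 0
    · rw [if_pos (mem_sons_bot.2 ⟨x, hx, hpx, rfl⟩), hpx, addOrderOf_of_nsmul_eq_zero hx hpx]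
      simp [hA x hx hpx]
    · have hns : zmultiples x ∉ sons p (⊥ : AddSubgroup G) := by
        intro h
        have := h.2.2
        rw [father_zmultiples, zmultiples_eq_bot] at this
        exact hpx this
      rw [if_neg hns, addOrderOf_of_nsmul_ne_zero hexp hpx,
        addOrderOf_of_nsmul_eq_zero hpx (nsmul_nsmul_eq_zero hexp x), father_zmultiples]
      simp [hA _ hpx (nsmul_nsmul_eq_zero hexp x), hB x hpx]
  rw [charSum_connSet, Finset.sum_congr rfl (fun H hH => key H (by simpa using hH)),
    Finset.sum_ite, Finset.sum_sub_distrib, Finset.sum_sub_distrib]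
  simp only [← Finset.sum_filter, Finset.sum_const, Finset.filter_filter, nsmul_eq_mul]
  have hcard : ∀ (Q : AddSubgroup G → Prop) [DecidablePred Q] (U : Set (AddSubgroup G)),
      (∀ H, Q H ↔ H ∈ U) → ((Finset.univ.filter Q).card : ℂ) = (U.ncard : ℂ) := by
    intro Q _ U h
    rw [Set.ncard_eq_toFinset_card']
    congr 2
    ext H
    simp [h]
  rw [hcard _ (sons p ⊥ ∩ T ∩ A) (fun H => by simp only [Set.mem_inter_iff]; tauto),
    hcard _ (sons p ⊥ ∩ T) (fun H => by simp only [Set.mem_inter_iff]; tauto),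
    hcard _ ((T \ sons p ⊥) ∩ B) (fun H => by
      simp only [Set.mem_inter_iff, Set.mem_sdiff]),
    hcard _ ((T \ sons p ⊥) ∩ {F | father p F ∈ A}) (fun H => by
      simp only [Set.mem_inter_iff, Set.mem_sdiff]; rfl)]
  push_cast
  ring

omit [Fact p.Prime] [Fintype G] in
open Classical in
lemma ncard_inter_singleton {α : Type*} (U : Set α) (a : α) :
    ((U ∩ {a}).ncard : ℤ) = if a ∈ U then 1 else 0 := by
  by_cases h : a ∈ U
  · rw [if_pos h, Set.inter_eq_right.2 (by simpa using h)]; simp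
  · rw [if_neg h, Set.inter_singleton_eq_empty.2 h]; simp

-- A kernel `zmultiples v` contains one subgroup of order `p` and one of order `p ^ 2`, so `A` and
-- `B` are singletons.
open Classical in
lemma charSum_of_ker_eq (hexp : ∀ x : G, (p ^ 2) • x = 0) {T : Set (AddSubgroup G)}
    (hT : T ⊆ Delta G) (hbot : ⊥ ∉ T) {χ : AddChar G ℂ} {v : G} (hv : p • v ≠ 0)
    (hχ : ∀ x, χ x = 1 ↔ x ∈ zmultiples v) :
    charSum (connSet T) χ = ((p * (if zmultiples (p • v) ∈ T then 1 else 0) -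
      (sons p ⊥ ∩ T).ncard + p ^ 2 * (if zmultiples v ∈ T then 1 else 0) -
      p * (sons p (zmultiples (p • v)) ∩ T).ncard : ℤ) : ℂ) := by
  have hvv : p • p • v = 0 := nsmul_nsmul_eq_zero hexp v
  rw [charSum_connSet_eq hexp hT hbot (A := {zmultiples (p • v)}) (B := {zmultiples v}),
    ncard_inter_singleton, ncard_inter_singleton]
  · have h1 : zmultiples (p • v) ∈ sons p (⊥ : AddSubgroup G) := mem_sons_bot.2 ⟨_, hv, hvv, rfl⟩
    have h2 : zmultiples v ∉ sons p (⊥ : AddSubgroup G) := by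
      rintro ⟨_, _, h⟩
      rw [father_zmultiples, zmultiples_eq_bot] at h
      exact hv h
    have h3 : (T \ sons p ⊥) ∩ {F | father p F ∈ ({zmultiples (p • v)} : Set _)} =
        sons p (zmultiples (p • v)) ∩ T := by
      ext F
      constructor
      · rintro ⟨⟨hF, _⟩, hf⟩
        exact ⟨⟨hT hF, fun h => hbot (h ▸ hF), hf⟩, hF⟩
      · rintro ⟨⟨h1, h2, h3⟩, hF⟩
        refine ⟨⟨hF, fun h => hv ?_⟩, h3⟩
        have := h.2.2
        rwa [h3, zmultiples_eq_bot] at this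
    rw [h3]
    simp [h1, h2]
  · intro x hx hpx
    rw [hχ, Set.mem_singleton_iff]
    refine ⟨fun h => zmultiples_eq_of_mem hexp hx hvv (mem_zmultiples_nsmul_of_mem hexp hpx hv h),
      fun h => ?_⟩
    exact zmultiples_le_of_mem (nsmul_mem (mem_zmultiples v) p) (h ▸ mem_zmultiples x)
  · intro x hpx
    rw [hχ, Set.mem_singleton_iff]
    exact ⟨zmultiples_eq_of_mem' hexp hpx, fun h => h ▸ mem_zmultiples x⟩

-- This kernel contains all `p`-torsion, so `A` is everything, while the subgroups of order `p ^ 2`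
-- inside it are the sons of `zmultiples (p • v)`.
open Classical in
lemma charSum_of_ker_eq_nsmul (hexp : ∀ x : G, (p ^ 2) • x = 0) {T : Set (AddSubgroup G)}
    (hT : T ⊆ Delta G) (hbot : ⊥ ∉ T) {χ : AddChar G ℂ} {v : G} (hv : p • v ≠ 0)
    (hχ : ∀ x, χ x = 1 ↔ p • x ∈ zmultiples v) :
    charSum (connSet T) χ = (((p - 1) * (sons p ⊥ ∩ T).ncard +
      p ^ 2 * (sons p (zmultiples (p • v)) ∩ T).ncard - p * (T \ sons p ⊥).ncard : ℤ) : ℂ) := by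
  have hvv : p • p • v = 0 := nsmul_nsmul_eq_zero hexp v
  rw [charSum_connSet_eq hexp hT hbot (A := Set.univ) (B := sons p (zmultiples (p • v)))]
  · have h3 : (T \ sons p ⊥) ∩ sons p (zmultiples (p • v)) =
        sons p (zmultiples (p • v)) ∩ T := by
      ext F
      constructor
      · rintro ⟨⟨hF, _⟩, hf⟩
        exact ⟨hf, hF⟩
      · rintro ⟨h3, hF⟩
        refine ⟨⟨hF, fun h => hv ?_⟩, h3⟩
        have := h.2.2
        rwa [h3.2.2, zmultiples_eq_bot] at this
    simp only [h3, Set.inter_univ, Set.mem_univ, Set.ofPred_true]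
    push_cast
    ring
  · intro x hx hpx
    simp [hχ, hpx]
  · intro x hpx
    rw [hχ, mem_sons_zmultiples hv]
    constructor
    · intro h
      exact ⟨x, hpx, zmultiples_eq_of_mem hexp hpx hvv
        (mem_zmultiples_nsmul_of_mem hexp (nsmul_nsmul_eq_zero hexp x) hv h), rfl⟩
    · rintro ⟨y, hy, h1, h2⟩
      have h3 : p • x ∈ zmultiples (p • y) :=
        nsmul_mem_zmultiples_nsmul p (h2 ▸ mem_zmultiples x)
      rw [h1] at h3
      exact zmultiples_le_of_mem (nsmul_mem (mem_zmultiples v) p) h3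

lemma ncard_connSet (hexp : ∀ x : G, (p ^ 2) • x = 0) {T : Set (AddSubgroup G)}
    (hT : T ⊆ Delta G) (hbot : ⊥ ∉ T) :
    ((connSet T).ncard : ℤ) = (p - 1) * (sons p ⊥ ∩ T).ncard +
      (p ^ 2 - p) * (T \ sons p ⊥).ncard := by
  have h := charSum_connSet_eq hexp hT hbot (χ := 0) (A := Set.univ) (B := Set.univ)
    (by simp) (by simp)
  rw [charSum_zero] at h
  simp only [Set.inter_univ, Set.mem_univ, Set.ofPred_true] at h
  rw [← Int.cast_natCast, Int.cast_inj] at h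
  rw [h]
  ring

end Eigenvalues

/-! ### Characters with prescribed kernel and the shape of the tree for `ℤ_{p²} ⊕ ℤ_{p²}`. -/

section Grp

variable {p : ℕ} [Fact p.Prime]

omit [Fact p.Prime] in
lemma grp_exp (x : Grp p 2) : (p ^ 2) • x = 0 := by
  have h : (p : ZMod (p ^ 2)) ^ 2 = 0 := by exact_mod_cast ZMod.natCast_self (p ^ 2)
  ext <;> simp [nsmul_eq_mul, h]

lemma zmod_isUnit_or (a : ZMod (p ^ 2)) :
    IsUnit a ∨ ∃ b : ZMod (p ^ 2), a = (p : ZMod (p ^ 2)) * b := by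
  by_cases h : p ∣ a.val
  · right
    obtain ⟨c, hc⟩ := h
    exact ⟨c, by rw [← ZMod.natCast_zmod_val a, hc]; push_cast; rfl⟩
  · left
    rw [← ZMod.natCast_zmod_val a, ZMod.isUnit_iff_coprime]
    exact (((Fact.out : p.Prime).coprime_iff_not_dvd.2 h).symm).pow_right 2

lemma zmod_eq_mul_of_mul_eq_zero {a : ZMod (p ^ 2)} (h : (p : ZMod (p ^ 2)) * a = 0) :
    ∃ b : ZMod (p ^ 2), a = (p : ZMod (p ^ 2)) * b := by
  refine (zmod_isUnit_or a).resolve_left fun hu => ?_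
  rw [hu.mul_left_eq_zero, ZMod.natCast_eq_zero_iff] at h
  have hp := (Fact.out : p.Prime)
  have := Nat.le_of_dvd hp.pos h
  nlinarith [hp.two_le]

lemma exists_nsmul_eq {x : Grp p 2} (h : p • x = 0) : ∃ w : Grp p 2, x = p • w := by
  have h1 := congrArg Prod.fst h
  have h2 := congrArg Prod.snd h
  change p • x.1 = 0 at h1
  change p • x.2 = 0 at h2
  rw [nsmul_eq_mul] at h1 h2
  obtain ⟨b, hb⟩ := zmod_eq_mul_of_mul_eq_zero h1
  obtain ⟨c, hc⟩ := zmod_eq_mul_of_mul_eq_zero h2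
  exact ⟨(b, c), by ext <;> simp [hb, hc]⟩

lemma exists_nsmul_ne_zero {y : Grp p 2} (hy : y ≠ 0) (h : p • y = 0) :
    ∃ v : Grp p 2, p • v ≠ 0 ∧ p • v = y := by
  obtain ⟨w, rfl⟩ := exists_nsmul_eq h
  exact ⟨w, hy, rfl⟩

/-- A cyclic subgroup of order `p ^ 2` is the kernel of a character. -/
lemma exists_addChar_ker_eq {v : Grp p 2} (hv : p • v ≠ 0) :
    ∃ χ : AddChar (Grp p 2) ℂ, ∀ x, χ x = 1 ↔ x ∈ zmultiples v := by
  -- The determinant with `v`. Since `p • v ≠ 0`, some coordinate of `v` is a unit, so the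
  -- determinant vanishes only on multiples of `v`.
  let f : Grp p 2 →+ ZMod (p ^ 2) :=
    AddMonoidHom.mk' (fun x => v.1 * x.2 - v.2 * x.1) (fun x y => by simp; ring)
  refine ⟨(ZMod.stdAddChar (N := p ^ 2)).compAddMonoidHom f, fun x => ?_⟩
  have h1 : (ZMod.stdAddChar (N := p ^ 2)).compAddMonoidHom f x = 1 ↔ f x = 0 := by
    rw [AddChar.compAddMonoidHom_apply, ← AddChar.map_zero_eq_one (ZMod.stdAddChar (N := p ^ 2))]
    exact ZMod.injective_stdAddChar.eq_iff
  rw [h1]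
  change v.1 * x.2 - v.2 * x.1 = 0 ↔ _
  constructor
  · intro h
    have hc : ∃ c : ZMod (p ^ 2), x = (c * v.1, c * v.2) := by
      rcases zmod_isUnit_or v.1 with h1 | ⟨b, hb⟩
      · obtain ⟨u, hu⟩ := h1.exists_right_inv
        refine ⟨x.1 * u, Prod.ext ?_ ?_⟩
        · linear_combination -x.1 * hu
        · linear_combination u * h - x.2 * hu
      rcases zmod_isUnit_or v.2 with h2 | ⟨c, hc⟩
      · obtain ⟨u, hu⟩ := h2.exists_right_inv
        refine ⟨x.2 * u, Prod.ext ?_ ?_⟩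
        · linear_combination -u * h - x.1 * hu
        · linear_combination -x.2 * hu
      · refine absurd ?_ hv
        have : v = p • ((b, c) : Grp p 2) := by ext <;> simp [hb, hc]
        rw [this, nsmul_nsmul_eq_zero grp_exp]
    obtain ⟨c, rfl⟩ := hc
    refine mem_zmultiples_iff.2 ⟨c.val, ?_⟩
    ext <;> simp
  · intro h
    obtain ⟨a, rfl⟩ := mem_zmultiples_iff.1 h
    simp
    ring

/-- Multiplication by `p` has equal kernel and image, so the order of the kernel squares to `p ^ 4`.
-/
lemma ncard_nsmul_eq_zero : {x : Grp p 2 | p • x = 0}.ncard = p ^ 2 := by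
  let f : Grp p 2 →+ Grp p 2 := nsmulAddMonoidHom p
  have h1 : Nat.card (Grp p 2) = Nat.card f.ker * Nat.card f.range := by
    rw [AddSubgroup.card_eq_card_quotient_mul_card_addSubgroup f.ker, mul_comm,
      Nat.card_congr (QuotientAddGroup.quotientKerEquivRange f).toEquiv]
  have h2 : f.ker = f.range := by
    ext x
    rw [AddMonoidHom.mem_ker, AddMonoidHom.mem_range]
    constructor
    · intro h
      obtain ⟨w, rfl⟩ := exists_nsmul_eq (p := p) h
      exact ⟨w, rfl⟩
    · rintro ⟨w, rfl⟩
      exact nsmul_nsmul_eq_zero grp_exp w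
  rw [← h2, Nat.card_prod, Nat.card_zmod, ← pow_two, ← pow_two] at h1
  have h3 := Nat.pow_left_injective two_ne_zero h1
  exact (Nat.card_coe_set_eq _).symm.trans h3.symm

lemma ncard_sons_bot : (sons p (⊥ : AddSubgroup (Grp p 2))).ncard = p + 1 := by
  have h1 : connSet (sons p (⊥ : AddSubgroup (Grp p 2))) = {x | p • x = 0} \ {0} := by
    ext x
    rw [mem_connSet]
    constructor
    · rintro ⟨_, h1, h2⟩
      rw [father_zmultiples, zmultiples_eq_bot] at h2
      refine ⟨h2, ?_⟩
      rintro rfl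
      simp at h1
    · rintro ⟨h1, h2⟩
      exact mem_sons_bot.2 ⟨x, h2, h1, rfl⟩
  have h2 := ncard_connSet (p := p) grp_exp (T := sons p (⊥ : AddSubgroup (Grp p 2)))
    (fun H hH => hH.1) (fun h => h.2.1 rfl)
  rw [h1, Set.inter_self, Set.sdiff_self, Set.ncard_sdiff_singleton_of_mem (by simp),
    ncard_nsmul_eq_zero] at h2
  have hp := (Fact.out : p.Prime).two_le
  rw [Nat.cast_sub (by nlinarith)] at h2
  push_cast at h2
  have h3 : ((p : ℤ) - 1) * ((sons p (⊥ : AddSubgroup (Grp p 2))).ncard - (p + 1)) = 0 := by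
    simp at h2
    linear_combination -h2
  rcases mul_eq_zero.1 h3 with h | h
  · omega
  · omega

/-- Take `T` to be all nontrivial cyclic subgroups: a nontrivial character sums to `-1` over the
nonzero elements, and the eigenvalue formula can be solved for the number of sons. -/
lemma ncard_sons {H : AddSubgroup (Grp p 2)} (hH : H ∈ sons p (⊥ : AddSubgroup (Grp p 2))) :
    (sons p H).ncard = p := by
  classical
  obtain ⟨y, hy, hpy, rfl⟩ := mem_sons_bot.1 hH
  obtain ⟨v, hv, rfl⟩ := exists_nsmul_ne_zero hy hpy
  obtain ⟨χ, hχ⟩ := exists_addChar_ker_eq hv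
  set T : Set (AddSubgroup (Grp p 2)) := Delta (Grp p 2) \ {⊥}
  have h1 := charSum_of_ker_eq (T := T) grp_exp Set.sdiff_subset (by simp [T]) hv hχ
  have hsub : ∀ H : AddSubgroup (Grp p 2), sons p H ∩ T = sons p H := fun H =>
    Set.inter_eq_left.2 fun F hF => ⟨hF.1, hF.2.1⟩
  have hne : v ≠ 0 := by
    rintro rfl
    simp at hv
  rw [if_pos ⟨zmultiples_mem_delta _, by simpa using hv⟩,
    if_pos ⟨zmultiples_mem_delta _, by simpa using hne⟩, hsub, hsub, ncard_sons_bot] at h1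
  have h2 : connSet T = {0}ᶜ := by
    ext x
    rw [mem_connSet]
    simp [T, zmultiples_mem_delta]
  have h3 : charSum (connSet T) χ = -1 := by
    have hχ0 : χ ≠ 0 := by
      rintro rfl
      have h4 : ∀ x : Grp p 2, x ∈ zmultiples v := by simpa using hχ
      have h5 : addOrderOf v = Nat.card (Grp p 2) := by
        rw [← Nat.card_zmultiples, (eq_top_iff' _).2 h4]; simp
      rw [addOrderOf_of_nsmul_ne_zero grp_exp hv, Nat.card_prod, Nat.card_zmod] at h5
      have h6 : 1 < p ^ 2 := Nat.one_lt_pow two_ne_zero (Fact.out : p.Prime).one_lt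
      nlinarith
    have h4 := AddChar.sum_eq_zero_iff_ne_zero.2 hχ0
    rw [h2, charSum]
    rw [← Finset.add_sum_erase _ _ (Finset.mem_univ 0), AddChar.map_zero_eq_one] at h4
    rw [← eq_neg_iff_add_eq_zero.2 ((add_comm _ _).trans h4)]
    congr 1
    ext x
    simp
  rw [h3] at h1
  have h4 : (-1 : ℤ) = p * 1 - ((p + 1 : ℕ) : ℤ) + p ^ 2 * 1 -
    p * (sons p (zmultiples (p • v))).ncard := by exact_mod_cast h1
  have hp0 : (p : ℤ) ≠ 0 := by exact_mod_cast (Fact.out : p.Prime).ne_zero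
  have h5 : (p : ℤ) * (sons p (zmultiples (p • v))).ncard = p * p := by
    push_cast at h4
    linear_combination h4
  exact_mod_cast mul_left_cancel₀ hp0 h5

end Grp

/-! ### The numerical classification of two-valued patterns. -/

section Combinatorics

variable {ι : Type*} [Fintype ι]

lemma exists_unique_of_sum_eq {f : ι → ℤ} {d : ℤ} (hd : 0 < d) (hf : ∀ i, f i = 0 ∨ f i = d)
    (hsum : ∑ i, f i = d) : ∃ j, f j = d ∧ ∀ k, k ≠ j → f k = 0 := by
  classical
  obtain ⟨j, hj⟩ : ∃ j, f j ≠ 0 := by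
    by_contra! h
    simp [h] at hsum
    omega
  have hj' := (hf j).resolve_left hj
  refine ⟨j, hj', fun k hk => ?_⟩
  rw [← Finset.add_sum_erase _ _ (Finset.mem_univ j), hj'] at hsum
  have h0 : ∑ i ∈ Finset.univ.erase j, f i = 0 := by linarith
  refine (Finset.sum_eq_zero_iff_of_nonneg fun i _ => ?_).1 h0 k
    (Finset.mem_erase.2 ⟨hk, Finset.mem_univ k⟩)
  rcases hf i with h | h <;> omega

/-- Classification of the pairs of functions on the set of subgroups of order `p` for which the
associated (normalised) eigenvalues take at most two values. -/
lemma classification {p : ℤ} (hp : 2 ≤ p) (hcard : (Fintype.card ι : ℤ) = p + 1) (t s : ι → ℤ)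
    (ht : ∀ i, t i = 0 ∨ t i = 1) (hs0 : ∀ i, 0 ≤ s i) (hsp : ∀ i, s i ≤ p) {V : Set ℤ}
    (hV : ∀ x ∈ V, ∀ y ∈ V, ∀ z ∈ V, x = y ∨ x = z ∨ y = z)
    (h1 : ∀ i, s i < p → t i - s i ∈ V) (h2 : ∀ i, 0 < s i → t i - s i + p ∈ V)
    (h3 : ∀ i, ∑ j, t j - ∑ j, s j + p * s i ∈ V) :
    (∃ b, 0 ≤ b ∧ b ≤ p - 1 ∧ ∀ i, s i = b + t i) ∨
    (p = 2 ∧ ∃ j, (t j = 0 ∧ s j = 2) ∧ ∀ k, k ≠ j → t k = 1 ∧ s k = 1) ∨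
    (p = 2 ∧ ∃ j, (t j = 1 ∧ s j = 0) ∧ ∀ k, k ≠ j → t k = 0 ∧ s k = 1) ∨
    ((∀ i, s i = 0) ∧ ∃ j, t j = 1 ∧ ∀ k, k ≠ j → t k = 0) ∨
    ((∀ i, s i = p) ∧ ∃ j, t j = 0 ∧ ∀ k, k ≠ j → t k = 1) ∨
    ((∀ i, s i = 0) ∧ ∀ i, t i = 1) ∨
    ((∀ i, s i = p) ∧ ∀ i, t i = 0) ∨
    ((∀ i, t i = 1) ∧ ∃ j, s j = p ∧ ∀ k, k ≠ j → s k = 0) ∨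
    ((∀ i, t i = 0) ∧ ∃ j, s j = 0 ∧ ∀ k, k ≠ j → s k = p) := by
  have hconst : ∀ c : ℤ, ∑ _i : ι, c = (p + 1) * c := by
    intro c
    rw [Finset.sum_const, Finset.card_univ, nsmul_eq_mul, hcard]
  by_cases hmix : ∃ i, 0 < s i ∧ s i < p
  · obtain ⟨i, hi0, hip⟩ := hmix
    obtain ⟨b, hb⟩ : ∃ b, b = s i - t i := ⟨_, rfl⟩
    have hti := ht i
    have hv : ∀ z ∈ V, z = -b ∨ z = p - b := by
      intro z hz
      have := hV _ (h1 i hip) _ (h2 i hi0) z hz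
      omega
    have hclose : ∀ j k, s j - s k ≤ 1 := by
      intro j k
      have e1 := hv _ (h3 j)
      have e2 := hv _ (h3 k)
      by_contra hc
      have : 2 * p ≤ p * (s j - s k) := by nlinarith
      rw [mul_sub] at this
      omega
    -- A deviation from `s j = b + t j` is a shift by `p`; since `s` varies by at most 1 and `t` by
    -- at most 1, it requires `p = 2`.
    have hj : ∀ j, s j = b + t j ∨ (p = 2 ∧ b = 0 ∧ t j = 0 ∧ s j = 2) ∨
        (p = 2 ∧ b = 1 ∧ t j = 1 ∧ s j = 0) := by
      intro j
      have e1 := fun h => hv _ (h1 j h)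
      have e2 := fun h => hv _ (h2 j h)
      have e3 := hclose i j
      have e4 := hclose j i
      have := ht j
      have := hs0 j
      have := hsp j
      by_cases hlt : s j < p
      · have := e1 hlt
        omega
      · have := e2 (by omega)
        omega
    by_cases hall : ∀ j, s j = b + t j
    · exact Or.inl ⟨b, by omega, by omega, hall⟩
    push Not at hall
    obtain ⟨j, hjb⟩ := hall
    rcases (hj j).resolve_left hjb with ⟨hp2, hb0, htj, hsj⟩ | ⟨hp2, hb1, htj, hsj⟩
    · right; left
      refine ⟨hp2, ?_⟩
      have hk : ∀ k, (t k = 1 ∧ s k = 1) ∨ (t k = 0 ∧ s k = 2) := by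
        intro k
        have := hj k
        have := hclose j k
        have := ht k
        omega
      -- Each deviating index contributes 2 and every other index 0. By `h3` the total is 0 or 2, so
      -- exactly one index deviates.
      have hsum : ∑ k, (s k - t k) = 2 := by
        have hle : s j - t j ≤ ∑ k, (s k - t k) :=
          Finset.single_le_sum (f := fun k => s k - t k)
            (fun k _ => by rcases hk k with h | h <;> omega) (Finset.mem_univ j)
        have := hv _ (h3 i)
        rw [Finset.sum_sub_distrib] at hle ⊢
        rw [hp2] at this
        omega
      obtain ⟨j', h1, h2⟩ := exists_unique_of_sum_eq (f := fun k => s k - t k) (by norm_num)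
        (fun k => by rcases hk k with h | h <;> omega) hsum
      refine ⟨j', ?_, fun k hkj => ?_⟩
      · have := hk j'; omega
      · have := hk k; have := h2 k hkj; omega
    · right; right; left
      refine ⟨hp2, ?_⟩
      have hk : ∀ k, (t k = 0 ∧ s k = 1) ∨ (t k = 1 ∧ s k = 0) := by
        intro k
        have := hj k
        have := hclose k j
        have := ht k
        omega
      -- The same count for the complementary pattern, with `1 - (s k - t k)` being 2 at a deviating
      -- index and 0 elsewhere.
      have hsum : ∑ k, (1 - (s k - t k)) = 2 := by
        have hle : 1 - (s j - t j) ≤ ∑ k, (1 - (s k - t k)) :=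
          Finset.single_le_sum (f := fun k => 1 - (s k - t k))
            (fun k _ => by rcases hk k with h | h <;> omega) (Finset.mem_univ j)
        have := hv _ (h3 i)
        rw [Finset.sum_sub_distrib, Finset.sum_sub_distrib, hconst] at hle ⊢
        rw [hp2] at this ⊢
        rw [hp2] at hle
        omega
      obtain ⟨j', h1, h2⟩ := exists_unique_of_sum_eq (f := fun k => 1 - (s k - t k)) (by norm_num)
        (fun k => by rcases hk k with h | h <;> omega) hsum
      refine ⟨j', ?_, fun k hkj => ?_⟩
      · have := hk j'; omega
      · have := hk k; have := h2 k hkj; omega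
  · have hs : ∀ i, s i = 0 ∨ s i = p := by
      intro i
      by_contra! h
      have := hs0 i
      have := hsp i
      exact hmix ⟨i, by omega, by omega⟩
    have htV : ∀ i, t i ∈ V := by
      intro i
      rcases hs i with h | h
      · have := h1 i (by omega)
        rwa [h, sub_zero] at this
      · have := h2 i (by omega)
        rwa [h, sub_add_cancel] at this
    have hne : Nonempty ι := by
      rw [← Fintype.card_pos_iff]
      omega
    -- When every `s i` is `0` or `p`, each `t i` itself lies in `V`; if `t` takes both values, then
    -- `V` is contained in `{0, 1}`.
    have htcase : (∀ i, t i = 0) ∨ (∀ i, t i = 1) ∨ ∀ z ∈ V, z = 0 ∨ z = 1 := by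
      by_cases ha : ∀ i, t i = 0
      · exact Or.inl ha
      by_cases hb : ∀ i, t i = 1
      · exact Or.inr (Or.inl hb)
      push Not at ha hb
      obtain ⟨i, hi⟩ := ha
      obtain ⟨j, hj⟩ := hb
      refine Or.inr (Or.inr fun z hz => ?_)
      have := hV _ (htV i) _ (htV j) z hz
      have := ht i
      have := ht j
      omega
    have hp4 : 2 * p ≤ p * p := by nlinarith
    by_cases hz : ∀ i, s i = 0
    · obtain ⟨i⟩ := hne
      rcases htcase with h | h | h
      · exact Or.inl ⟨0, le_rfl, by omega, fun i => by rw [hz, h]; rfl⟩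
      · right; right; right; right; right; left
        exact ⟨hz, h⟩
      · have h4 := h _ (h3 i)
        simp only [hz, Finset.sum_const_zero, mul_zero, sub_zero, add_zero] at h4
        rcases h4 with h4 | h4
        · have : ∀ i, t i = 0 := fun i =>
            (Finset.sum_eq_zero_iff_of_nonneg fun i _ => by rcases ht i with h | h <;> omega).1
              h4 i (Finset.mem_univ i)
          exact Or.inl ⟨0, le_rfl, by omega, fun i => by rw [hz, this]; rfl⟩
        · right; right; right; left
          exact ⟨hz, exists_unique_of_sum_eq one_pos ht h4⟩
    by_cases hz' : ∀ i, s i = p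
    · obtain ⟨i⟩ := hne
      rcases htcase with h | h | h
      · right; right; right; right; right; right; left
        exact ⟨hz', h⟩
      · exact Or.inl ⟨p - 1, by omega, le_rfl, fun i => by rw [hz', h]; ring⟩
      · have h4 := h _ (h3 i)
        simp only [hz', hconst] at h4
        have h5 : ∑ j, (1 - t j) = 0 ∨ ∑ j, (1 - t j) = 1 := by
          rw [Finset.sum_sub_distrib, hconst]
          rw [add_mul] at h4
          omega
        rcases h5 with h5 | h5
        · have : ∀ i, 1 - t i = 0 := fun i =>
            (Finset.sum_eq_zero_iff_of_nonneg fun i _ => by rcases ht i with h | h <;> omega).1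
              h5 i (Finset.mem_univ i)
          exact Or.inl ⟨p - 1, by omega, le_rfl, fun i => by have := this i; rw [hz']; omega⟩
        · right; right; right; right; left
          obtain ⟨j, hj, hk⟩ := exists_unique_of_sum_eq (f := fun j => 1 - t j) one_pos
            (fun i => by have := ht i; omega) h5
          exact ⟨hz', j, by omega, fun k hkj => by have := hk k hkj; omega⟩
    push Not at hz hz'
    obtain ⟨k, hk⟩ := hz
    obtain ⟨j, hj⟩ := hz'
    have hk' := (hs k).resolve_left hk
    have hj' := (hs j).resolve_right hj
    have e1 := h3 k
    have e2 := h3 j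
    rw [hk'] at e1
    rw [hj', mul_zero] at e2
    have hsk : s k ≤ ∑ i, s i := Finset.single_le_sum (fun i _ => hs0 i) (Finset.mem_univ k)
    have hsj : p - s j ≤ ∑ i, (p - s i) :=
      Finset.single_le_sum (f := fun i => p - s i) (fun i _ => by have := hsp i; omega)
        (Finset.mem_univ j)
    rw [Finset.sum_sub_distrib, hconst, add_mul] at hsj
    -- Both `0` and `p` occur in `s`, so `V` contains two values differing by `p²`. For constant `t`
    -- one of them must equal that constant, which fixes `∑ s`; for mixed `t` they cannot both lie
    -- in `{0, 1}`.
    rcases htcase with h | h | h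
    · right; right; right; right; right; right; right; right
      have e3 := hV _ e1 _ e2 _ (htV k)
      simp only [h, Finset.sum_const_zero] at e3
      obtain ⟨j, hj, hk⟩ := exists_unique_of_sum_eq (f := fun i => p - s i) (d := p) (by omega)
        (fun i => by have := hs i; omega) (by rw [Finset.sum_sub_distrib, hconst, add_mul]; omega)
      exact ⟨h, j, by omega, fun k hkj => by have := hk k hkj; omega⟩
    · right; right; right; right; right; right; right; left
      have e3 := hV _ e1 _ e2 _ (htV k)
      simp only [h, hconst] at e3
      rw [add_mul] at e3
      obtain ⟨j, hj, hk⟩ := exists_unique_of_sum_eq (f := s) (d := p) (by omega) hs (by omega)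
      exact ⟨h, j, hj, hk⟩
    · have := h _ e1
      have := h _ e2
      omega

end Combinatorics

/-! ### From a strongly regular Cayley graph to the numerical problem. -/

section Connection

variable {p : ℕ} [Fact p.Prime]

/-- A set that is stable under multiplication by integers prime to `p` is defined by a set of
cyclic subgroups. -/
lemma connSet_image_zmultiples {S : Set (Grp p 2)} (h0 : 0 ∉ S)
    (h : ∀ t : ℕ, t.Coprime (p ^ 2) → ∀ x ∈ S, t • x ∈ S) : connSet (zmultiples '' S) = S := by
  ext x
  rw [mem_connSet]
  refine ⟨?_, fun hx => ⟨x, hx, rfl⟩⟩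
  rintro ⟨y, hy, hxy⟩
  have hy0 : y ≠ 0 := fun h => h0 (h ▸ hy)
  have hx : x ∈ zmultiples y := hxy ▸ mem_zmultiples x
  obtain ⟨t, rfl⟩ := (AddSubmonoid.mem_multiples_iff _ _).1 (mem_multiples_iff_mem_zmultiples.2 hx)
  refine h t ?_ y hy
  have hp := (Fact.out : p.Prime)
  refine ((hp.coprime_iff_not_dvd.2 fun hd => ?_).symm).pow_right 2
  obtain ⟨c, rfl⟩ := hd
  have h1 : y ∈ zmultiples ((p * c) • y) := hxy ▸ mem_zmultiples y
  have h2 : p • y = 0 := by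
    refine nsmul_eq_zero_of_mem p ?_ h1
    rw [mul_smul, nsmul_nsmul_eq_zero grp_exp]
  rw [mul_comm, mul_smul, h2] at h1
  simp at h1
  exact hy0 h1

omit [Fact p.Prime] in
lemma sdiff_sons_bot {T : Set (AddSubgroup (Grp p 2))} (hT : T ⊆ Delta (Grp p 2)) (hbot : ⊥ ∉ T)
    {F : AddSubgroup (Grp p 2)} (hF : F ∈ T \ sons p ⊥) :
    father p F ∈ sons p (⊥ : AddSubgroup (Grp p 2)) := by
  obtain ⟨x, rfl⟩ := mem_delta_iff.1 (hT hF.1)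
  rw [father_zmultiples]
  refine mem_sons_bot.2 ⟨_, fun h => hF.2 ?_, nsmul_nsmul_eq_zero grp_exp x, rfl⟩
  refine mem_sons_bot.2 ⟨x, ?_, h, rfl⟩
  rintro rfl
  exact hbot (by simpa using hF.1)

open Classical in
lemma sum_sons_bot_indicator (T : Set (AddSubgroup (Grp p 2))) :
    ∑ H : ↥(sons p (⊥ : AddSubgroup (Grp p 2))), (if H.1 ∈ T then (1 : ℤ) else 0) =
      (sons p ⊥ ∩ T).ncard := by
  rw [Finset.sum_set_coe (sons p (⊥ : AddSubgroup (Grp p 2)))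
    (f := fun H => if H ∈ T then (1 : ℤ) else 0), Finset.sum_boole, Set.ncard_eq_toFinset_card']
  congr 2
  ext H
  simp

open Classical in
lemma sum_sons_bot_ncard {T : Set (AddSubgroup (Grp p 2))} (hT : T ⊆ Delta (Grp p 2))
    (hbot : ⊥ ∉ T) :
    ∑ H : ↥(sons p (⊥ : AddSubgroup (Grp p 2))), ((sons p H.1 ∩ T).ncard : ℤ) =
      (T \ sons p ⊥).ncard := by
  rw [Finset.sum_set_coe (sons p (⊥ : AddSubgroup (Grp p 2)))
    (f := fun H => ((sons p H ∩ T).ncard : ℤ)), Set.ncard_eq_toFinset_card' (T \ _),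
    Finset.card_eq_sum_card_fiberwise (f := father p)
      (t := (sons p (⊥ : AddSubgroup (Grp p 2))).toFinset)]
  · rw [Nat.cast_sum]
    refine Finset.sum_congr rfl fun H hH => ?_
    rw [Set.ncard_eq_toFinset_card']
    congr 2
    ext F
    rw [Set.mem_toFinset] at hH
    simp only [Set.mem_toFinset, Finset.mem_filter, Set.mem_inter_iff, Set.mem_sdiff]
    constructor
    · rintro ⟨h1, h2⟩
      refine ⟨⟨h2, fun h => hH.2.1 ?_⟩, h1.2.2⟩
      rw [← h1.2.2, h.2.2]
    · rintro ⟨⟨h1, h2⟩, h3⟩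
      exact ⟨⟨hT h1, fun h => hbot (h ▸ h1), h3⟩, h1⟩
  · intro F hF
    simp only [Set.coe_toFinset] at hF ⊢
    exact sdiff_sons_bot hT hbot hF

lemma ncard_sons_inter_le {H : AddSubgroup (Grp p 2)} (hH : H ∈ sons p ⊥)
    (T : Set (AddSubgroup (Grp p 2))) : (sons p H ∩ T).ncard ≤ p :=
  (Set.ncard_le_ncard Set.inter_subset_left).trans (ncard_sons hH).le

lemma ncard_sons_inter_add {H : AddSubgroup (Grp p 2)} (hH : H ∈ sons p ⊥)
    (T : Set (AddSubgroup (Grp p 2))) : (sons p H ∩ T).ncard + (sons p H ∩ Tᶜ).ncard = p := by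
  have := Set.ncard_inter_add_ncard_sdiff_eq_ncard (sons p H) T
  rwa [ncard_sons hH, Set.sdiff_eq] at this

lemma notMem_of_ncard_eq_zero {T U : Set (AddSubgroup (Grp p 2))} (h : (U ∩ T).ncard = 0)
    {F : AddSubgroup (Grp p 2)} (hF : F ∈ U) : F ∉ T := fun hFT => by
  rw [Set.ncard_eq_zero] at h
  exact (h ▸ (⟨hF, hFT⟩ : F ∈ U ∩ T) : F ∈ (∅ : Set _))

open Classical in
/-- The classification of the eigenvalue patterns applied to a strongly regular Cayley graph. -/
lemma classification_connSet {T : Set (AddSubgroup (Grp p 2))} (hT : T ⊆ Delta (Grp p 2))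
    (hbot : ⊥ ∉ T) (hS : IsSRCG (connSet T))
    {t s : ↥(sons p (⊥ : AddSubgroup (Grp p 2))) → ℤ}
    (ht : t = fun H => if H.1 ∈ T then 1 else 0)
    (hs : s = fun H => ((sons p H.1 ∩ T).ncard : ℤ)) :
    (∃ b : ℤ, 0 ≤ b ∧ b ≤ p - 1 ∧ ∀ i, s i = b + t i) ∨
    ((p : ℤ) = 2 ∧ ∃ j, (t j = 0 ∧ s j = 2) ∧ ∀ k, k ≠ j → t k = 1 ∧ s k = 1) ∨
    ((p : ℤ) = 2 ∧ ∃ j, (t j = 1 ∧ s j = 0) ∧ ∀ k, k ≠ j → t k = 0 ∧ s k = 1) ∨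
    ((∀ i, s i = 0) ∧ ∃ j, t j = 1 ∧ ∀ k, k ≠ j → t k = 0) ∨
    ((∀ i, s i = p) ∧ ∃ j, t j = 0 ∧ ∀ k, k ≠ j → t k = 1) ∨
    ((∀ i, s i = 0) ∧ ∀ i, t i = 1) ∨
    ((∀ i, s i = p) ∧ ∀ i, t i = 0) ∨
    ((∀ i, t i = 1) ∧ ∃ j, s j = p ∧ ∀ k, k ≠ j → s k = 0) ∨
    ((∀ i, t i = 0) ∧ ∃ j, s j = 0 ∧ ∀ k, k ≠ j → s k = p) := by
  have hp := (Fact.out : p.Prime)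
  have hpZ : (p : ℤ) ≠ 0 := by exact_mod_cast hp.ne_zero
  obtain ⟨l, m, -, hq⟩ := charSum_quadratic hS
  set τ : ℤ := ((sons p ⊥ ∩ T).ncard : ℤ) with hτ
  set κ : ℤ := ((connSet T).ncard : ℤ) - m with hκ
  have hroot : ∀ (χ : AddChar (Grp p 2) ℂ) (x : Grp p 2), χ x ≠ 1 → ∀ z : ℤ,
      charSum (connSet T) χ = z → z ^ 2 = κ + (l - m) * z := by
    intro χ x hx z hz
    have := hq χ (by rintro rfl; exact hx (by simp))
    rw [hz] at this
    exact_mod_cast this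
  have hex : ∀ v : Grp p 2, ∃ x, x ∉ zmultiples v := by
    intro v
    by_contra! h
    have h5 : addOrderOf v = Nat.card (Grp p 2) := by
      rw [← Nat.card_zmultiples, (eq_top_iff' _).2 h]; simp
    have h6 : addOrderOf v ≤ p ^ 2 :=
      Nat.le_of_dvd (by have := hp.pos; positivity) (addOrderOf_dvd_of_nsmul_eq_zero (grp_exp v))
    rw [h5, Nat.card_prod, Nat.card_zmod] at h6
    have h7 : 1 < p ^ 2 := Nat.one_lt_pow two_ne_zero hp.one_lt
    nlinarith
  have hE : ∀ (H F : AddSubgroup (Grp p 2)), H ∈ sons p (⊥ : AddSubgroup (Grp p 2)) →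
      F ∈ sons p H → ∀ z : ℤ, z = p * (if H ∈ T then 1 else 0) - τ +
        p ^ 2 * (if F ∈ T then 1 else 0) - p * (sons p H ∩ T).ncard →
      z ^ 2 = κ + (l - m) * z := by
    intro H F hH hF z hz
    obtain ⟨y, hy, hpy, rfl⟩ := mem_sons_bot.1 hH
    obtain ⟨v, hv, hvy, rfl⟩ := (mem_sons_zmultiples hy).1 hF
    obtain ⟨χ, hχ⟩ := exists_addChar_ker_eq hv
    obtain ⟨x, hx⟩ := hex v
    refine hroot χ x (fun h => hx ((hχ x).1 h)) z ?_
    rw [charSum_of_ker_eq grp_exp hT hbot hv hχ, hvy, hz]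
  have hM : ∀ H : AddSubgroup (Grp p 2), H ∈ sons p (⊥ : AddSubgroup (Grp p 2)) →
      ∀ z : ℤ, z = (p - 1) * τ + p ^ 2 * (sons p H ∩ T).ncard - p * (T \ sons p ⊥).ncard →
      z ^ 2 = κ + (l - m) * z := by
    intro H hH z hz
    obtain ⟨y, hy, hpy, rfl⟩ := mem_sons_bot.1 hH
    obtain ⟨v, hv, rfl⟩ := exists_nsmul_ne_zero hy hpy
    obtain ⟨χ, hχ⟩ := exists_addChar_ker_eq hv
    -- Otherwise the `p ^ 2` torsion elements, all multiples of `p`, would lie in a subgroup of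
    -- order `p`.
    have hker : ∃ x : Grp p 2, p • x ∉ zmultiples v := by
      by_contra! h
      have h1 : {x : Grp p 2 | p • x = 0} ⊆ (zmultiples (p • v) : Set (Grp p 2)) := by
        intro x hx
        obtain ⟨w, rfl⟩ := exists_nsmul_eq (p := p) hx
        exact mem_zmultiples_nsmul_of_mem grp_exp hx hv (h w)
      have h2 := Set.ncard_le_ncard h1
      rw [ncard_nsmul_eq_zero, ← Nat.card_coe_set_eq] at h2
      have h3 : Nat.card (zmultiples (p • v)) = p := by
        rw [Nat.card_zmultiples, addOrderOf_of_nsmul_eq_zero hv hpy]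
      have h4 : p ^ 2 ≤ p := h2.trans h3.le
      nlinarith [hp.two_le]
    obtain ⟨x, hx⟩ := hker
    have hχ' : ∀ x, (χ.compAddMonoidHom (nsmulAddMonoidHom p)) x = 1 ↔ p • x ∈ zmultiples v :=
      fun x => hχ (p • x)
    refine hroot _ x (fun h => hx ((hχ' x).1 h)) z ?_
    rw [charSum_of_ker_eq_nsmul grp_exp hT hbot hv hχ', hz]
  -- The normalisation `z ↦ p * z - τ` carries the numerical values to eigenvalues; `V` collects the
  -- preimages of the roots of the quadratic.
  refine classification (V := {z | (p * z - τ) ^ 2 = κ + (l - m) * (p * z - τ)})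
    (by exact_mod_cast hp.two_le) ?_ t s ?_ ?_ ?_ ?_ ?_ ?_ ?_
  · rw [← Nat.card_eq_fintype_card, Nat.card_coe_set_eq, ncard_sons_bot]; simp
  · intro i
    rw [ht]
    by_cases h : i.1 ∈ T <;> simp [h]
  · intro i
    rw [hs]; positivity
  · intro i
    simp only [hs]
    exact_mod_cast ncard_sons_inter_le i.2 T
  · intro x hx y hy z hz
    simp only [Set.mem_ofPred_eq] at hx hy hz
    by_contra! h
    obtain ⟨h1, h2, h3⟩ := h
    have e1 : (p : ℤ) * (x - y) * (p * (x + y) - 2 * τ - (l - m)) = 0 := by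
      linear_combination hx - hy
    have e2 : (p : ℤ) * (x - z) * (p * (x + z) - 2 * τ - (l - m)) = 0 := by
      linear_combination hx - hz
    have f1 := (mul_eq_zero.1 e1).resolve_left (mul_ne_zero hpZ (sub_ne_zero.2 h1))
    have f2 := (mul_eq_zero.1 e2).resolve_left (mul_ne_zero hpZ (sub_ne_zero.2 h2))
    have : (p : ℤ) * (y - z) = 0 := by linear_combination f1 - f2
    exact (mul_ne_zero hpZ (sub_ne_zero.2 h3)) this
  · intro i hi
    simp only [hs] at hi
    obtain ⟨F, hF, hFT⟩ : ∃ F ∈ sons p i.1, F ∉ T := by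
      by_contra! h
      rw [Set.inter_eq_left.2 h, ncard_sons i.2] at hi
      exact lt_irrefl _ hi
    refine hE i.1 F i.2 hF _ ?_
    rw [if_neg hFT, ht, hs]
    ring
  · intro i hi
    simp only [hs] at hi
    obtain ⟨F, hF, hFT⟩ : (sons p i.1 ∩ T).Nonempty := by
      rw [← Set.ncard_pos]; exact_mod_cast hi
    refine hE i.1 F i.2 hF _ ?_
    rw [if_pos hFT, ht, hs]
    ring
  · intro i
    refine hM i.1 i.2 _ ?_
    rw [ht, hs, sum_sons_bot_indicator, sum_sons_bot_ncard hT hbot]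
    ring

end Connection

/-! ### Patterns in the tree that come from subgroups. -/

section Trivial

variable {p : ℕ}

/-- `T` contains exactly those nontrivial cyclic subgroups that lie in a given subgroup. -/
def IsSubgroupLike (T : Set (AddSubgroup (Grp p 2))) : Prop :=
  ∃ K : AddSubgroup (Grp p 2), ∀ x ≠ 0, zmultiples x ∈ T ↔ x ∈ K

lemma IsSubgroupLike.isTrivial {T : Set (AddSubgroup (Grp p 2))}
    (h : IsSubgroupLike T) : IsTrivial (connSet T) := by
  obtain ⟨K, hK⟩ := h
  refine ⟨K, Or.inl ?_⟩
  ext x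
  rw [Set.mem_insert_iff, mem_connSet]
  by_cases hx : x = 0
  · simp [hx]
  · simp [hx, hK x hx]

lemma IsSubgroupLike.isTrivial_of_compl {T : Set (AddSubgroup (Grp p 2))} (hbot : ⊥ ∉ T)
    (h : IsSubgroupLike Tᶜ) : IsTrivial (connSet T) := by
  obtain ⟨K, hK⟩ := h
  refine ⟨K, Or.inr ?_⟩
  ext x
  rw [Set.mem_compl_iff, mem_connSet]
  by_cases hx : x = 0
  · simp [hx, hbot]
  · simp [← hK x hx]

lemma isSubgroupLike_of_leaves {T : Set (AddSubgroup (Grp p 2))} (K : AddSubgroup (Grp p 2))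
    (h1 : ∀ x : Grp p 2, x ≠ 0 → p • x = 0 → (zmultiples x ∈ T ↔ x ∈ K))
    (h2 : ∀ x : Grp p 2, p • x ≠ 0 → (zmultiples x ∈ T ↔ x ∈ K)) : IsSubgroupLike T := by
  refine ⟨K, fun x hx => ?_⟩
  by_cases hpx : p • x = 0
  · exact h1 x hx hpx
  · exact h2 x hpx

variable [Fact p.Prime] {T : Set (AddSubgroup (Grp p 2))}

omit [Fact p.Prime] in
lemma zmultiples_nsmul_mem_sons {x : Grp p 2} (hpx : p • x ≠ 0) :
    zmultiples (p • x) ∈ sons p (⊥ : AddSubgroup (Grp p 2)) ∧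
      zmultiples x ∈ sons p (zmultiples (p • x)) :=
  ⟨mem_sons_bot.2 ⟨_, hpx, nsmul_nsmul_eq_zero grp_exp x, rfl⟩,
    (mem_sons_zmultiples hpx).2 ⟨x, hpx, rfl, rfl⟩⟩

omit [Fact p.Prime] in
lemma isSubgroupLike_bot (ht : ∀ H ∈ sons p (⊥ : AddSubgroup (Grp p 2)), H ∉ T)
    (hs : ∀ H ∈ sons p (⊥ : AddSubgroup (Grp p 2)), ∀ F ∈ sons p H, F ∉ T) :
    IsSubgroupLike T := by
  refine isSubgroupLike_of_leaves ⊥ (fun x hx hpx => ?_) (fun x hpx => ?_)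
  · simpa [hx] using ht _ (mem_sons_bot.2 ⟨x, hx, hpx, rfl⟩)
  · have hx : x ≠ 0 := by rintro rfl; simp at hpx
    obtain ⟨h1, h2⟩ := zmultiples_nsmul_mem_sons hpx
    simpa [hx] using hs _ h1 _ h2

omit [Fact p.Prime] in
lemma isSubgroupLike_torsion (ht : ∀ H ∈ sons p (⊥ : AddSubgroup (Grp p 2)), H ∈ T)
    (hs : ∀ H ∈ sons p (⊥ : AddSubgroup (Grp p 2)), ∀ F ∈ sons p H, F ∉ T) :
    IsSubgroupLike T := by
  refine isSubgroupLike_of_leaves (nsmulAddMonoidHom p).ker (fun x hx hpx => ?_)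
    (fun x hpx => ?_)
  · exact iff_of_true (ht _ (mem_sons_bot.2 ⟨x, hx, hpx, rfl⟩)) hpx
  · obtain ⟨h1, h2⟩ := zmultiples_nsmul_mem_sons hpx
    exact iff_of_false (hs _ h1 _ h2) hpx

lemma isSubgroupLike_line {J : AddSubgroup (Grp p 2)}
    (hJ : J ∈ sons p (⊥ : AddSubgroup (Grp p 2)))
    (ht : ∀ H ∈ sons p (⊥ : AddSubgroup (Grp p 2)), H ∈ T ↔ H = J)
    (hs : ∀ H ∈ sons p (⊥ : AddSubgroup (Grp p 2)), ∀ F ∈ sons p H, F ∉ T) :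
    IsSubgroupLike T := by
  obtain ⟨y, hy, hpy, rfl⟩ := mem_sons_bot.1 hJ
  refine isSubgroupLike_of_leaves (zmultiples y) (fun x hx hpx => ?_) (fun x hpx => ?_)
  · rw [ht _ (mem_sons_bot.2 ⟨x, hx, hpx, rfl⟩)]
    exact ⟨fun h => h ▸ mem_zmultiples x, zmultiples_eq_of_mem grp_exp hx hpy⟩
  · obtain ⟨h1, h2⟩ := zmultiples_nsmul_mem_sons hpx
    exact iff_of_false (hs _ h1 _ h2) fun h => hpx (nsmul_eq_zero_of_mem p hpy h)

/-- The subgroup is the preimage of `J` under multiplication by `p`: it contains all `p`-torsion and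
the sons of `J`. -/
lemma isSubgroupLike_comap {J : AddSubgroup (Grp p 2)}
    (hJ : J ∈ sons p (⊥ : AddSubgroup (Grp p 2)))
    (ht : ∀ H ∈ sons p (⊥ : AddSubgroup (Grp p 2)), H ∈ T)
    (hs : ∀ H ∈ sons p (⊥ : AddSubgroup (Grp p 2)), ∀ F ∈ sons p H, F ∈ T ↔ H = J) :
    IsSubgroupLike T := by
  obtain ⟨y, hy, hpy, rfl⟩ := mem_sons_bot.1 hJ
  refine isSubgroupLike_of_leaves ((zmultiples y).comap (nsmulAddMonoidHom p))
    (fun x hx hpx => ?_) (fun x hpx => ?_)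
  · refine iff_of_true (ht _ (mem_sons_bot.2 ⟨x, hx, hpx, rfl⟩)) ?_
    rw [mem_comap]
    change p • x ∈ _
    rw [hpx]
    exact zero_mem _
  · obtain ⟨h1, h2⟩ := zmultiples_nsmul_mem_sons hpx
    rw [hs _ h1 _ h2, mem_comap]
    exact ⟨fun h => h ▸ mem_zmultiples (p • x), zmultiples_eq_of_mem grp_exp hpx hpy⟩

lemma isSubgroupLike_cyclic {J F : AddSubgroup (Grp p 2)}
    (hJ : J ∈ sons p (⊥ : AddSubgroup (Grp p 2))) (hF : F ∈ sons p J)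
    (ht : ∀ H ∈ sons p (⊥ : AddSubgroup (Grp p 2)), H ∈ T ↔ H = J)
    (hs : ∀ H ∈ sons p (⊥ : AddSubgroup (Grp p 2)), ∀ F' ∈ sons p H, F' ∈ T ↔ F' = F) :
    IsSubgroupLike T := by
  obtain ⟨y, hy, hpy, rfl⟩ := mem_sons_bot.1 hJ
  obtain ⟨v, hv, hvy, rfl⟩ := (mem_sons_zmultiples hy).1 hF
  refine isSubgroupLike_of_leaves (zmultiples v) (fun x hx hpx => ?_) (fun x hpx => ?_)
  · rw [ht _ (mem_sons_bot.2 ⟨x, hx, hpx, rfl⟩), ← hvy]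
    refine ⟨fun h => ?_, fun h => ?_⟩
    · exact zmultiples_le_of_mem (nsmul_mem (mem_zmultiples v) p) (h ▸ mem_zmultiples x)
    · exact zmultiples_eq_of_mem grp_exp hx (nsmul_nsmul_eq_zero grp_exp v)
        (mem_zmultiples_nsmul_of_mem grp_exp hpx hv h)
  · obtain ⟨h1, h2⟩ := zmultiples_nsmul_mem_sons hpx
    rw [hs _ h1 _ h2]
    exact ⟨fun h => h ▸ mem_zmultiples x, zmultiples_eq_of_mem' grp_exp hpx⟩

end Trivial

/-! ### The Clebsch graph as a Cayley graph on `ℤ₄ ⊕ ℤ₄`. -/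

section Clebsch

/-- The Gray code on two bits, as a map to `ZMod 4`. -/
def gray (x y : Bool) : ZMod 4 := if x then (if y then 2 else 1) else (if y then 3 else 0)

/-- The Gray code on pairs of bits. -/
def grayPair (w : Fin 4 → Bool) : ZMod 4 × ZMod 4 := (gray (w 0) (w 1), gray (w 2) (w 3))

lemma grayPair_injective : Function.Injective grayPair := by
  have h : ∀ x y x' y', gray x y = gray x' y' → x = x' ∧ y = y' := by decide
  intro w w' hw
  obtain ⟨h0, h1⟩ := h _ _ _ _ (congrArg Prod.fst hw)
  obtain ⟨h2, h3⟩ := h _ _ _ _ (congrArg Prod.snd hw)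
  ext i
  fin_cases i
  · simpa using congrArg (· = true) h0
  · simpa using congrArg (· = true) h1
  · simpa using congrArg (· = true) h2
  · simpa using congrArg (· = true) h3

lemma hammingDist_fin_four (w w' : Fin 4 → Bool) :
    hammingDist w w' = (if w 0 = w' 0 then 0 else 1) + (if w 1 = w' 1 then 0 else 1) +
      (if w 2 = w' 2 then 0 else 1) + (if w 3 = w' 3 then 0 else 1) := by
  rw [hammingDist, Finset.card_filter, Fin.sum_univ_four]
  simp only [ne_eq, ite_not]

/-- Under the Gray code, flipping one bit of a pair changes its image by `±1` and flipping both
changes it by 2. One flip in all thus gives `(±1, 0)` or `(0, ±1)`, and four flips give `(2, 2)`. -/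
lemma clebsch_adj_iff (w w' : Fin 4 → Bool) :
    clebsch.Adj w w' ↔ grayPair w' - grayPair w ∈
      ({(1, 0), (-1, 0), (0, 1), (0, -1), (2, 2)} : Set (ZMod 4 × ZMod 4)) := by
  have h : ∀ a b c d a' b' c' d' : Bool,
      ((if a = a' then 0 else 1) + (if b = b' then 0 else 1) + (if c = c' then 0 else 1) +
        (if d = d' then 0 else 1) = 1 ∨
      (if a = a' then 0 else 1) + (if b = b' then 0 else 1) + (if c = c' then 0 else 1) +
        (if d = d' then 0 else 1) = 4) ↔
      ((gray a' b', gray c' d') - (gray a b, gray c d) = ((1, 0) : ZMod 4 × ZMod 4) ∨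
      (gray a' b', gray c' d') - (gray a b, gray c d) = ((-1, 0) : ZMod 4 × ZMod 4) ∨
      (gray a' b', gray c' d') - (gray a b, gray c d) = ((0, 1) : ZMod 4 × ZMod 4) ∨
      (gray a' b', gray c' d') - (gray a b, gray c d) = ((0, -1) : ZMod 4 × ZMod 4) ∨
      (gray a' b', gray c' d') - (gray a b, gray c d) = ((2, 2) : ZMod 4 × ZMod 4)) := by
    decide
  have h1 : clebsch.Adj w w' ↔ (hammingDist w w' = 1 ∨ hammingDist w w' = 4) := by
    rw [clebsch, SimpleGraph.fromRel_adj, hammingDist_comm w' w, or_self]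
    refine and_iff_right_of_imp ?_
    rintro h rfl
    simp at h
  rw [h1, hammingDist_fin_four]
  exact h _ _ _ _ _ _ _ _

/-- The linear map `(m, n) ↦ m a + n b`. -/
def combHom (a b : Grp 2 2) : ZMod 4 × ZMod 4 →+ Grp 2 2 :=
  AddMonoidHom.mk' (fun z => ((z.1 * a.1 + z.2 * b.1 : ZMod 4), (z.1 * a.2 + z.2 * b.2 : ZMod 4)))
    (fun x y => by
      refine Prod.ext ?_ ?_
      · change (x.1 + y.1) * a.1 + (x.2 + y.2) * b.1 =
          (x.1 * a.1 + x.2 * b.1) + (y.1 * a.1 + y.2 * b.1)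
        -- The identity is proved over `ZMod 4` and matched by unfolding, because the coordinates of
        -- `Grp 2 2` have type `ZMod (2 ^ 2)`.
        exact (by intros; ring : ∀ m n m' n' c d : ZMod 4,
          (m + m') * c + (n + n') * d = (m * c + n * d) + (m' * c + n' * d)) _ _ _ _ _ _
      · exact (by intros; ring : ∀ m n m' n' c d : ZMod 4,
          (m + m') * c + (n + n') * d = (m * c + n * d) + (m' * c + n' * d)) _ _ _ _ _ _)

lemma combHom_natCast (a b : Grp 2 2) (m n : ℕ) : combHom a b (m, n) = m • a + n • b := by
  have h1 : combHom a b (1, 0) = a := by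
    refine Prod.ext ?_ ?_
    · exact (by intros; ring : ∀ c d : ZMod 4, 1 * c + 0 * d = c) _ _
    · exact (by intros; ring : ∀ c d : ZMod 4, 1 * c + 0 * d = c) _ _
  have h2 : combHom a b (0, 1) = b := by
    refine Prod.ext ?_ ?_
    · exact (by intros; ring : ∀ c d : ZMod 4, 0 * c + 1 * d = d) _ _
    · exact (by intros; ring : ∀ c d : ZMod 4, 0 * c + 1 * d = d) _ _
  have h3 : ((m, n) : ZMod 4 × ZMod 4) = m • (1, 0) + n • (0, 1) := by ext <;> simp
  rw [h3, map_add, map_nsmul, map_nsmul, h1, h2]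

/-- A nonzero `z` in `ℤ₄ ⊕ ℤ₄` is an involution or doubles to one, so it suffices that the three
involutions survive; their images are `2 • a`, `2 • b` and `2 • a + 2 • b`. -/
lemma combHom_injective {a b : Grp 2 2} (ha : 2 • a ≠ 0) (hb : 2 • b ≠ 0)
    (hab : 2 • a ≠ 2 • b) : Function.Injective (combHom a b) := by
  have hz : ∀ z : ZMod 4 × ZMod 4, z ≠ 0 →
      (z = (2, 0) ∨ z = (0, 2) ∨ z = (2, 2)) ∨ z + z = (2, 0) ∨ z + z = (0, 2) ∨ z + z = (2, 2) := by
    decide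
  have h1 : combHom a b (2, 0) ≠ 0 := by
    have := combHom_natCast a b 2 0
    rw [zero_nsmul, add_zero] at this
    exact fun h => ha (this.symm.trans h)
  have h2 : combHom a b (0, 2) ≠ 0 := by
    have := combHom_natCast a b 0 2
    rw [zero_nsmul, zero_add] at this
    exact fun h => hb (this.symm.trans h)
  have h3 : combHom a b (2, 2) ≠ 0 := by
    have := combHom_natCast a b 2 2
    refine fun h => hab ?_
    have h4 : 2 • a + 2 • b = 0 := this.symm.trans h
    have h5 : 2 • 2 • b = 0 := nsmul_nsmul_eq_zero grp_exp b
    rw [two_nsmul (2 • b)] at h5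
    exact (add_right_cancel (h4.trans h5.symm))
  refine (injective_iff_map_eq_zero _).2 fun z h => ?_
  by_contra hne
  have hzz : combHom a b (z + z) = 0 := by rw [map_add, h, add_zero]
  rcases hz z hne with (h' | h' | h') | h' | h' | h'
  · exact h1 (h' ▸ h)
  · exact h2 (h' ▸ h)
  · exact h3 (h' ▸ h)
  · exact h1 (h' ▸ hzz)
  · exact h2 (h' ▸ hzz)
  · exact h3 (h' ▸ hzz)

lemma nonempty_iso_clebsch {Γ : SimpleGraph (Grp 2 2)} {a b : Grp 2 2} (ha : 2 • a ≠ 0)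
    (hb : 2 • b ≠ 0) (hab : 2 • a ≠ 2 • b)
    (hΓ : ∀ x y, Γ.Adj x y ↔ y - x ∈ ({a, -a, b, -b, 2 • a + 2 • b} : Set (Grp 2 2))) :
    Nonempty (Γ ≃g clebsch) := by
  have hinj := combHom_injective ha hb hab
  have hbij : Function.Bijective (combHom a b ∘ grayPair) := by
    rw [Fintype.bijective_iff_injective_and_card]
    refine ⟨hinj.comp grayPair_injective, ?_⟩
    simp [ZMod.card]
  let e := Equiv.ofBijective _ hbij
  refine ⟨(SimpleGraph.Iso.symm ⟨e, fun {w w'} => ?_⟩)⟩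
  rw [hΓ, clebsch_adj_iff]
  change combHom a b (grayPair w') - combHom a b (grayPair w) ∈ _ ↔ _
  rw [← map_sub]
  generalize grayPair w' - grayPair w = z
  have e1 : combHom a b (1, 0) = a := by simpa using combHom_natCast a b 1 0
  have e2 : combHom a b (0, 1) = b := by simpa using combHom_natCast a b 0 1
  have e3 : combHom a b (-1, 0) = -a := by
    have := map_neg (combHom a b) (1, 0)
    rw [e1] at this
    simpa using this
  have e4 : combHom a b (0, -1) = -b := by
    have := map_neg (combHom a b) (0, 1)
    rw [e2] at this
    simpa using this
  have e5 : combHom a b (2, 2) = 2 • a + 2 • b := combHom_natCast a b 2 2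
  simp only [Set.mem_insert_iff, Set.mem_singleton_iff]
  have key : ∀ {u g}, combHom a b u = g → (combHom a b z = g ↔ z = u) := by
    rintro u g rfl
    exact hinj.eq_iff
  exact or_congr (key e1) (or_congr (key e3) (or_congr (key e2) (or_congr (key e4) (key e5))))

lemma ncard_clebsch_neighborSet (w : Fin 4 → Bool) : (clebsch.neighborSet w).ncard = 5 := by
  have hbij : Function.Bijective grayPair := by
    rw [Fintype.bijective_iff_injective_and_card]
    exact ⟨grayPair_injective, by simp [ZMod.card]⟩
  let e := (Equiv.ofBijective _ hbij).trans (Equiv.subRight (grayPair w))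
  have h : clebsch.neighborSet w = e.symm ''
      (({(1, 0), (-1, 0), (0, 1), (0, -1), (2, 2)} : Finset (ZMod 4 × ZMod 4)) : Set _) := by
    ext w'
    rw [Equiv.image_symm_eq_preimage, SimpleGraph.mem_neighborSet, clebsch_adj_iff]
    simp [e]
  rw [h, Set.ncard_image_of_injective _ e.symm.injective, Set.ncard_coe_finset]
  decide

end Clebsch

/-! ### Homogeneous sets for `n = 2`, and graphs defined by sets of subgroups. -/

section Homogeneous

variable {p : ℕ} [Fact p.Prime] {T : Set (AddSubgroup (Grp p 2))}

lemma card_of_mem_sons_bot {H : AddSubgroup (Grp p 2)}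
    (hH : H ∈ sons p (⊥ : AddSubgroup (Grp p 2))) : Nat.card H = p := by
  obtain ⟨x, hx, hpx, rfl⟩ := mem_sons_bot.1 hH
  rw [Nat.card_zmultiples, addOrderOf_of_nsmul_eq_zero hx hpx]

lemma mem_sons_bot_of_card {H : AddSubgroup (Grp p 2)} (hH : H ∈ Delta (Grp p 2))
    (hc : Nat.card H = p) : H ∈ sons p (⊥ : AddSubgroup (Grp p 2)) := by
  obtain ⟨x, rfl⟩ := mem_delta_iff.1 hH
  rw [Nat.card_zmultiples] at hc
  refine mem_sons_bot.2 ⟨x, ?_, addOrderOf_dvd_iff_nsmul_eq_zero.1 hc.dvd, rfl⟩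
  rintro rfl
  rw [addOrderOf_zero] at hc
  exact (Fact.out : p.Prime).one_lt.ne hc

-- Length 0 means the root, which is outside `T` and so has exactly `a₁` sons in it; length 1 means
-- a son of the root.
open Classical in
lemma isHomogeneous_iff {a₁ a₂ : ℕ} : IsHomogeneous p 2 ![a₁, a₂] T ↔
    (a₁ ≤ p + 1 ∧ a₂ ≤ p - 1) ∧ T ⊆ Delta (Grp p 2) ∧ ⊥ ∉ T ∧ (sons p ⊥ ∩ T).ncard = a₁ ∧
      ∀ H ∈ sons p (⊥ : AddSubgroup (Grp p 2)),
        (sons p H ∩ T).ncard = if H ∈ T then a₂ + 1 else a₂ := by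
  rw [IsHomogeneous]
  simp only [Fin.forall_fin_two, Fin.isValue, Matrix.cons_val_zero, Matrix.cons_val_one,
    Fin.val_zero, Fin.val_one, if_true, one_ne_zero, if_false, pow_zero, pow_one]
  refine and_congr_right fun _ => and_congr_right fun _ => and_congr_right fun hbot => ?_
  constructor
  · intro h
    refine ⟨?_, fun H hH => (h H hH.1).2 (card_of_mem_sons_bot hH)⟩
    rw [(h ⊥ (mem_delta_iff.2 ⟨0, by simp⟩)).1 (by simp), if_neg hbot]
  · rintro ⟨h1, h2⟩ H hH
    refine ⟨fun hc => ?_, fun hc => h2 H (mem_sons_bot_of_card hH hc)⟩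
    rw [eq_bot_of_card_eq H hc, if_neg hbot, h1]

omit [Fact p.Prime] in
lemma graphOf_adj (hbot : ⊥ ∉ T) (x y : Grp p 2) :
    (graphOf T).Adj x y ↔ zmultiples (y - x) ∈ T := by
  have h : (0 : Grp p 2) ∉ connSet T := by rwa [mem_connSet, zmultiples_zero_eq_bot]
  refine (addCayley_adj_iff h ?_ x y).trans mem_connSet
  ext z
  rw [Set.mem_neg, mem_connSet, mem_connSet, zmultiples_neg]

omit [Fact p.Prime] in
lemma ncard_neighborSet_graphOf (hbot : ⊥ ∉ T) :
    ((graphOf T).neighborSet 0).ncard = (connSet T).ncard := by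
  congr 1
  ext x
  rw [SimpleGraph.mem_neighborSet, graphOf_adj hbot, sub_zero, mem_connSet]

/-- The nontrivial cyclic subgroups outside `T`. -/
def complSet (T : Set (AddSubgroup (Grp p 2))) : Set (AddSubgroup (Grp p 2)) :=
  (Delta (Grp p 2) \ {⊥}) \ T

omit [Fact p.Prime] in
lemma sons_inter_complSet (T : Set (AddSubgroup (Grp p 2))) (H : AddSubgroup (Grp p 2)) :
    sons p H ∩ complSet T = sons p H ∩ Tᶜ := by
  ext F
  exact ⟨fun h => ⟨h.1, h.2.2⟩, fun h => ⟨h.1, ⟨h.1.1, h.1.2.1⟩, h.2⟩⟩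

omit [Fact p.Prime] in
lemma graphOf_complSet (hbot : ⊥ ∉ T) : graphOf (complSet T) = (graphOf T)ᶜ := by
  ext x y
  rw [graphOf_adj (fun h => h.1.2 rfl), SimpleGraph.compl_adj, graphOf_adj hbot]
  have h : zmultiples (y - x) = ⊥ ↔ x = y := by rw [zmultiples_eq_bot, sub_eq_zero, eq_comm]
  simp [complSet, zmultiples_mem_delta, h]

end Homogeneous

/-! ### The exceptional graphs over `ℤ₄ ⊕ ℤ₄`. -/

section Exceptional

variable {T : Set (AddSubgroup (Grp 2 2))}

lemma eq_of_zmultiples_eq {x y : Grp 2 2} (hx : x ≠ 0) (hy : 2 • y = 0)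
    (h : zmultiples x = zmultiples y) : x = y := by
  obtain ⟨k, rfl⟩ := mem_zmultiples_iff.1 (h ▸ mem_zmultiples x : x ∈ zmultiples y)
  have hy' : (2 : ℤ) • y = 0 := by exact_mod_cast hy
  rcases Int.even_or_odd' k with ⟨c, rfl | rfl⟩
  · rw [mul_comm, mul_smul, hy', smul_zero] at hx
    exact absurd rfl hx
  · rw [add_smul, one_smul, mul_comm, mul_smul, hy', smul_zero, zero_add]

lemma eq_or_eq_neg_of_zmultiples_eq {x y : Grp 2 2} (hx : 2 • x ≠ 0)
    (h : zmultiples x = zmultiples y) : x = y ∨ x = -y := by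
  obtain ⟨k, rfl⟩ := mem_zmultiples_iff.1 (h ▸ mem_zmultiples x : x ∈ zmultiples y)
  have hy' : (4 : ℤ) • y = 0 := by exact_mod_cast grp_exp y
  have hx' : (2 * k) • y ≠ 0 := by
    rw [mul_smul]; exact_mod_cast hx
  have hk : ∃ c, k = 1 + c * 4 ∨ k = -1 + c * 4 ∨ 2 * k = c * 4 := by
    rcases Int.even_or_odd' k with ⟨c, rfl | rfl⟩
    · exact ⟨c, by omega⟩
    · rcases Int.even_or_odd' c with ⟨d, rfl | rfl⟩
      · exact ⟨d, by omega⟩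
      · exact ⟨d + 1, by omega⟩
  obtain ⟨c, rfl | rfl | hc⟩ := hk
  · left; rw [add_smul, mul_smul, hy', smul_zero, one_smul, add_zero]
  · right; rw [add_smul, mul_smul, hy', smul_zero, neg_smul, one_smul, add_zero]
  · rw [hc, mul_smul, hy', smul_zero] at hx'
    exact absurd rfl hx'

/-- The sets of subgroups that define the exceptional graphs over `ℤ₄ ⊕ ℤ₄`. -/
structure IsExceptional (T : Set (AddSubgroup (Grp 2 2))) (J : AddSubgroup (Grp 2 2)) : Prop where
  subset : T ⊆ Delta (Grp 2 2)
  bot_notMem : ⊥ ∉ T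
  mem_sons : J ∈ sons 2 (⊥ : AddSubgroup (Grp 2 2))
  notMem : J ∉ T
  sons_subset : sons 2 J ⊆ T
  mem_of_ne : ∀ H ∈ sons 2 (⊥ : AddSubgroup (Grp 2 2)), H ≠ J → H ∈ T
  ncard_of_ne : ∀ H ∈ sons 2 (⊥ : AddSubgroup (Grp 2 2)), H ≠ J → (sons 2 H ∩ T).ncard = 1

variable {J : AddSubgroup (Grp 2 2)}

-- The block is `sons 2 J`. Once it is removed, `J` has no sons left, while the other two subgroups
-- of order 2 lie in the set with one son each, so `T \ sons 2 J` is `(2, 0)`-homogeneous.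
open Classical in
lemma IsExceptional.graphOf_mem (h : IsExceptional T J) : graphOf T ∈ Gamma2 2 := by
  have hsJ : ∀ H, sons 2 H ∩ (T \ sons 2 J) = if H = J then ∅ else sons 2 H ∩ T := by
    intro H
    split_ifs with hH
    · rw [hH]
      ext F
      simp +contextual
    · ext F
      refine ⟨fun hF => ⟨hF.1, hF.2.1⟩, fun hF => ⟨hF.1, hF.2, fun hFJ => hH ?_⟩⟩
      rw [← hF.1.2.2, hFJ.2.2]
  have hJbot : (⊥ : AddSubgroup (Grp 2 2)) ≠ J := fun hJ => h.mem_sons.2.1 hJ.symm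
  have hnotJ : ∀ H ∈ sons 2 (⊥ : AddSubgroup (Grp 2 2)), H ∉ sons 2 J := fun H hH hHJ =>
    hJbot (hH.2.2.symm.trans hHJ.2.2)
  refine ⟨T \ sons 2 J, sons 2 J, isHomogeneous_iff.2 ⟨by norm_num,
    Set.sdiff_subset.trans h.subset, fun hb => h.bot_notMem hb.1, ?_, fun H hH => ?_⟩,
    ⟨?_, J, h.mem_sons.1, rfl⟩, ?_, Set.disjoint_sdiff_right, ?_⟩
  · rw [hsJ, if_neg hJbot]
    have : sons 2 (⊥ : AddSubgroup (Grp 2 2)) ∩ T = sons 2 ⊥ \ {J} := by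
      ext H
      refine ⟨fun hH => ⟨hH.1, fun hHJ => h.notMem (hHJ ▸ hH.2)⟩, fun hH => ⟨hH.1, ?_⟩⟩
      exact h.mem_of_ne H hH.1 hH.2
    rw [this, Set.ncard_sdiff_singleton_of_mem h.mem_sons, ncard_sons_bot]
  · rw [hsJ]
    by_cases hHJ : H = J
    · rw [if_pos hHJ, if_neg (fun hm => h.notMem (hHJ ▸ hm.1)), Set.ncard_empty]
    · rw [if_neg hHJ, if_pos ⟨h.mem_of_ne H hH hHJ, hnotJ H hH⟩, h.ncard_of_ne H hH hHJ]
  · rw [← Set.ncard_pos, ncard_sons h.mem_sons]; norm_num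
  · intro F hF
    obtain ⟨y, hy, hpy, rfl⟩ := mem_sons_bot.1 h.mem_sons
    obtain ⟨v, hv, hvy, rfl⟩ := (mem_sons_zmultiples hy).1 hF
    rw [Nat.card_zmultiples, addOrderOf_of_nsmul_ne_zero grp_exp hv]
  · rw [Set.sdiff_union_of_subset h.sons_subset]

lemma IsExceptional.exists_son (h : IsExceptional T J) {H : AddSubgroup (Grp 2 2)}
    (hH : H ∈ sons 2 (⊥ : AddSubgroup (Grp 2 2))) (hHJ : H ≠ J) :
    ∃ a : Grp 2 2, 2 • a ≠ 0 ∧ zmultiples (2 • a) = H ∧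
      ∀ F ∈ sons 2 H, F ∉ T ↔ F = zmultiples a := by
  have h1 := ncard_sons_inter_add hH T
  rw [h.ncard_of_ne H hH hHJ] at h1
  obtain ⟨F, hF⟩ := Set.ncard_eq_one.1 (by omega : (sons 2 H ∩ Tᶜ).ncard = 1)
  have hFm : F ∈ sons 2 H ∩ Tᶜ := by rw [hF]; rfl
  obtain ⟨y, hy, hpy, rfl⟩ := mem_sons_bot.1 hH
  obtain ⟨a, ha, hay, rfl⟩ := (mem_sons_zmultiples hy).1 hFm.1
  refine ⟨a, ha, hay, fun F hFs => ⟨fun hFT => ?_, ?_⟩⟩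
  · have : F ∈ sons 2 (zmultiples y) ∩ Tᶜ := ⟨hFs, hFT⟩
    rw [hF] at this
    exact this
  · rintro rfl
    exact hFm.2

/-- Outside `T` remain `J` and one cyclic subgroup of order 4 above each of the other two subgroups
of order 2. With `a`, `b` generating the latter, the complement has connection set `{a, -a, b, -b, 2
• a + 2 • b}`. -/
lemma IsExceptional.nonempty_iso (h : IsExceptional T J) :
    Nonempty ((graphOf T)ᶜ ≃g clebsch) := by
  have hcard : (sons 2 (⊥ : AddSubgroup (Grp 2 2)) \ {J}).ncard = 2 := by
    rw [Set.ncard_sdiff_singleton_of_mem h.mem_sons, ncard_sons_bot]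
  obtain ⟨H₁, H₂, hne, hH⟩ := Set.ncard_eq_two.1 hcard
  have hH₁ : H₁ ∈ sons 2 (⊥ : AddSubgroup (Grp 2 2)) \ {J} := by rw [hH]; simp
  have hH₂ : H₂ ∈ sons 2 (⊥ : AddSubgroup (Grp 2 2)) \ {J} := by rw [hH]; simp
  obtain ⟨a, ha, rfl, hFa⟩ := h.exists_son hH₁.1 hH₁.2
  obtain ⟨b, hb, rfl, hFb⟩ := h.exists_son hH₂.1 hH₂.2
  have hab : 2 • a ≠ 2 • b := fun hab => hne (by rw [hab])
  have h2a : 2 • 2 • a = 0 := nsmul_nsmul_eq_zero grp_exp a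
  have h2b : 2 • 2 • b = 0 := nsmul_nsmul_eq_zero grp_exp b
  have hc2 : 2 • (2 • a + 2 • b) = 0 := by rw [nsmul_add, h2a, h2b, add_zero]
  have hc0 : 2 • a + 2 • b ≠ 0 := by
    intro hc
    rw [two_nsmul (2 • b)] at h2b
    exact hab (add_right_cancel (hc.trans h2b.symm))
  have hsons : ∀ H ∈ sons 2 (⊥ : AddSubgroup (Grp 2 2)),
      H = J ∨ H = zmultiples (2 • a) ∨ H = zmultiples (2 • b) := by
    intro H hHs
    by_cases hHJ : H = J
    · exact Or.inl hHJ
    · have : H ∈ sons 2 (⊥ : AddSubgroup (Grp 2 2)) \ {J} := ⟨hHs, hHJ⟩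
      rw [hH] at this
      exact Or.inr this
  -- There are three involutions, and the one different from `2 • a` and `2 • b` must generate `J`.
  have hcJ : zmultiples (2 • a + 2 • b) = J := by
    rcases hsons _ (mem_sons_bot.2 ⟨_, hc0, hc2, rfl⟩) with hJ | hJ | hJ
    · exact hJ
    · exact absurd (left_eq_add.1 (eq_of_zmultiples_eq hc0 h2a hJ).symm) hb
    · exact absurd (right_eq_add.1 (eq_of_zmultiples_eq hc0 h2b hJ).symm) ha
  refine nonempty_iso_clebsch ha hb hab fun x y => ?_
  rw [SimpleGraph.compl_adj, graphOf_adj h.bot_notMem, ne_comm, ← sub_ne_zero]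
  generalize y - x = z
  simp only [Set.mem_insert_iff, Set.mem_singleton_iff]
  have haT : zmultiples a ∉ T := (hFa _ (zmultiples_nsmul_mem_sons ha).2).2 rfl
  have hbT : zmultiples b ∉ T := (hFb _ (zmultiples_nsmul_mem_sons hb).2).2 rfl
  have ha0 : a ≠ 0 := by rintro rfl; simp at ha
  have hb0 : b ≠ 0 := by rintro rfl; simp at hb
  constructor
  · rintro ⟨hz, hzT⟩
    by_cases h2z : 2 • z = 0
    · have hzs := mem_sons_bot.2 ⟨z, hz, h2z, rfl⟩
      have hzJ : zmultiples z = J := by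
        by_contra hzJ
        exact hzT (h.mem_of_ne _ hzs hzJ)
      exact Or.inr (Or.inr (Or.inr (Or.inr (eq_of_zmultiples_eq hz hc2 (hzJ.trans hcJ.symm)))))
    · obtain ⟨h1, h2⟩ := zmultiples_nsmul_mem_sons h2z
      rcases hsons _ h1 with h3 | h3 | h3
      · rw [h3] at h2
        exact absurd (h.sons_subset h2) hzT
      · rw [h3] at h2
        rcases eq_or_eq_neg_of_zmultiples_eq h2z ((hFa _ h2).1 hzT) with h4 | h4 <;> simp [h4]
      · rw [h3] at h2
        rcases eq_or_eq_neg_of_zmultiples_eq h2z ((hFb _ h2).1 hzT) with h4 | h4 <;> simp [h4]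
  · rintro (rfl | rfl | rfl | rfl | rfl)
    · exact ⟨ha0, haT⟩
    · exact ⟨neg_ne_zero.2 ha0, by rwa [zmultiples_neg]⟩
    · exact ⟨hb0, hbT⟩
    · exact ⟨neg_ne_zero.2 hb0, by rwa [zmultiples_neg]⟩
    · exact ⟨hc0, hcJ ▸ h.notMem⟩

end Exceptional

/-! ### Isomorphisms, complements and valencies. -/

section Iso

/-- Isomorphic graphs have isomorphic complements. -/
def isoCompl {V W : Type*} {Γ : SimpleGraph V} {Γ' : SimpleGraph W} (e : Γ ≃g Γ') :
    Γᶜ ≃g Γ'ᶜ :=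
  ⟨e.toEquiv, by
    intro x y
    have := e.map_adj_iff (v := x) (w := y)
    simp only [SimpleGraph.compl_adj]
    exact and_congr (not_congr e.toEquiv.injective.eq_iff) (not_congr this)⟩

lemma ncard_neighborSet_of_iso {V W : Type*} {Γ : SimpleGraph V} {Γ' : SimpleGraph W}
    (e : Γ ≃g Γ') (v : V) : (Γ.neighborSet v).ncard = (Γ'.neighborSet (e v)).ncard := by
  rw [← Nat.card_coe_set_eq, ← Nat.card_coe_set_eq]
  exact Nat.card_congr (e.mapNeighborSet v)

lemma ncard_neighborSet_compl {V : Type*} [Finite V] (Γ : SimpleGraph V) (v : V) :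
    (Γᶜ.neighborSet v).ncard + (Γ.neighborSet v).ncard + 1 = Nat.card V := by
  have h : Γᶜ.neighborSet v = (insert v (Γ.neighborSet v))ᶜ := by
    ext w
    simp [SimpleGraph.compl_adj, eq_comm]
  have h1 := Set.ncard_add_ncard_compl (insert v (Γ.neighborSet v))
  rw [Set.ncard_insert_of_notMem (by simp)] at h1
  rw [h]
  omega

end Iso

/-! ### Assembling the classification. -/

section Main

/-- Counting generators gives `|S| = τ + 2σ`, with `τ` members of order 2 and `σ` of order 4.
Homogeneity gives `σ = 3 a₂ + τ`, so `|S| = 3 (τ + 2 a₂)`. -/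
lemma three_dvd_ncard_connSet {T : Set (AddSubgroup (Grp 2 2))} {a₁ a₂ : ℕ}
    (h : IsHomogeneous 2 2 ![a₁, a₂] T) : 3 ∣ (connSet T).ncard := by
  classical
  obtain ⟨-, hT, hbot, h1, h2⟩ := isHomogeneous_iff.1 h
  have e1 := ncard_connSet (p := 2) grp_exp hT hbot
  have e2 : ∀ H : ↥(sons 2 (⊥ : AddSubgroup (Grp 2 2))), ((sons 2 H.1 ∩ T).ncard : ℤ) =
      a₂ + if H.1 ∈ T then 1 else 0 := by
    intro H
    rw [h2 H.1 H.2]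
    split_ifs <;> simp
  have e3 := sum_sons_bot_ncard hT hbot
  simp only [e2] at e3
  rw [Finset.sum_add_distrib, sum_sons_bot_indicator, Finset.sum_const, Finset.card_univ,
    ← Nat.card_eq_fintype_card, Nat.card_coe_set_eq, ncard_sons_bot] at e3
  rw [← e3] at e1
  have : ((connSet T).ncard : ℤ) = 3 * ((sons 2 ⊥ ∩ T).ncard + 2 * a₂) := by
    rw [e1]
    simp
    ring
  omega

lemma not_homogeneous_of_iso {S : Set (Grp 2 2)}
    (hiso : Nonempty (SimpleGraph.addCayley S ≃g clebsch) ∨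
      Nonempty (SimpleGraph.addCayley S ≃g clebschᶜ)) {T : Set (AddSubgroup (Grp 2 2))} {a₁ a₂ : ℕ}
    (h : IsHomogeneous 2 2 ![a₁, a₂] T) (hST : SimpleGraph.addCayley S = graphOf T) : False := by
  have h3 := three_dvd_ncard_connSet h
  rw [← ncard_neighborSet_graphOf h.2.2.1] at h3
  rw [hST] at hiso
  rcases hiso with ⟨⟨e⟩⟩ | ⟨⟨e⟩⟩
  · rw [ncard_neighborSet_of_iso e, ncard_clebsch_neighborSet] at h3
    omega
  · have h4 := ncard_neighborSet_compl clebsch (e 0)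
    rw [← ncard_neighborSet_of_iso e, ncard_clebsch_neighborSet] at h4
    have h5 : Nat.card (Fin 4 → Bool) = 16 := by simp
    omega

/-- Homogeneous sets with excluded parameters define trivial graphs. -/
lemma isTrivial_of_homogeneous {p : ℕ} [Fact p.Prime] {T : Set (AddSubgroup (Grp p 2))}
    {a₁ a₂ : ℕ} (h : IsHomogeneous p 2 ![a₁, a₂] T)
    (ha : (a₁, a₂) ∈ ({(1, 0), (p, p - 1), (0, 0), (p + 1, p - 1)} : Set (ℕ × ℕ))) :
    IsTrivial (connSet T) := by
  classical
  have hp := (Fact.out : p.Prime).pos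
  obtain ⟨-, hT, hbot, h1, h2⟩ := isHomogeneous_iff.1 h
  -- Complementation replaces the parameters `(a₁, a₂)` by `(p + 1 - a₁, p - 1 - a₂)`, so only `(0,
  -- 0)` and `(1, 0)` need treatment: the zero subgroup and a cyclic subgroup of order `p ^ 2`.
  have hc1 : (sons p (⊥ : AddSubgroup (Grp p 2)) ∩ Tᶜ).ncard = p + 1 - a₁ := by
    have := Set.ncard_inter_add_ncard_sdiff_eq_ncard (sons p (⊥ : AddSubgroup (Grp p 2))) T
    rw [ncard_sons_bot, Set.sdiff_eq, h1] at this
    omega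
  have hc2 : ∀ H ∈ sons p (⊥ : AddSubgroup (Grp p 2)), (sons p H ∩ Tᶜ).ncard =
      if H ∈ Tᶜ then p - a₂ else p - 1 - a₂ := by
    intro H hH
    have := ncard_sons_inter_add hH T
    have h3 := h2 H hH
    by_cases hHT : H ∈ T
    · rw [if_pos hHT] at h3
      rw [if_neg (fun h => h hHT)]
      omega
    · rw [if_neg hHT] at h3
      rw [if_pos (show H ∈ Tᶜ from hHT)]
      omega
  have hzero : ∀ U : Set (AddSubgroup (Grp p 2)),
      (sons p (⊥ : AddSubgroup (Grp p 2)) ∩ U).ncard = 0 →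
      (∀ H ∈ sons p (⊥ : AddSubgroup (Grp p 2)), (sons p H ∩ U).ncard =
        if H ∈ U then 1 else 0) → IsSubgroupLike U := by
    intro U hU1 hU2
    refine isSubgroupLike_bot (fun H hH => notMem_of_ncard_eq_zero hU1 hH) fun H hH F hF => ?_
    have hHU := notMem_of_ncard_eq_zero hU1 hH
    have := hU2 H hH
    rw [if_neg hHU] at this
    exact notMem_of_ncard_eq_zero this hF
  have hone : ∀ U : Set (AddSubgroup (Grp p 2)),
      (sons p (⊥ : AddSubgroup (Grp p 2)) ∩ U).ncard = 1 →
      (∀ H ∈ sons p (⊥ : AddSubgroup (Grp p 2)), (sons p H ∩ U).ncard =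
        if H ∈ U then 1 else 0) → IsSubgroupLike U := by
    intro U hU1 hU2
    obtain ⟨J, hJ⟩ := Set.ncard_eq_one.1 hU1
    have hJm : J ∈ sons p (⊥ : AddSubgroup (Grp p 2)) ∩ U := by rw [hJ]; rfl
    have hJiff : ∀ H ∈ sons p (⊥ : AddSubgroup (Grp p 2)), H ∈ U ↔ H = J := by
      intro H hH
      refine ⟨fun hHU => ?_, fun h => h ▸ hJm.2⟩
      have : H ∈ sons p (⊥ : AddSubgroup (Grp p 2)) ∩ U := ⟨hH, hHU⟩
      rw [hJ] at this
      exact this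
    have hJ1 := hU2 J hJm.1
    rw [if_pos hJm.2] at hJ1
    obtain ⟨F, hF⟩ := Set.ncard_eq_one.1 hJ1
    have hFm : F ∈ sons p J ∩ U := by rw [hF]; rfl
    refine isSubgroupLike_cyclic hJm.1 hFm.1 hJiff fun H hH F' hF' => ?_
    refine ⟨fun hFU => ?_, fun h => h ▸ hFm.2⟩
    by_cases hHJ : H = J
    · have : F' ∈ sons p J ∩ U := ⟨hHJ ▸ hF', hFU⟩
      rw [hF] at this
      exact this
    · have := hU2 H hH
      rw [if_neg (fun hHU => hHJ ((hJiff H hH).1 hHU))] at this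
      exact absurd hFU (notMem_of_ncard_eq_zero this hF')
  simp only [Set.mem_insert_iff, Set.mem_singleton_iff, Prod.mk.injEq] at ha
  rcases ha with ⟨rfl, rfl⟩ | ⟨rfl, rfl⟩ | ⟨rfl, rfl⟩ | ⟨rfl, rfl⟩
  · exact (hone T h1 h2).isTrivial
  · refine (hone Tᶜ (by omega) fun H hH => ?_).isTrivial_of_compl hbot
    rw [hc2 H hH]
    split_ifs <;> omega
  · exact (hzero T h1 h2).isTrivial
  · refine (hzero Tᶜ (by omega) fun H hH => ?_).isTrivial_of_compl hbot
    rw [hc2 H hH]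
    split_ifs <;> omega

/-- A strongly regular Cayley graph defined by a set of subgroups is trivial, homogeneous, or one
of the exceptional graphs. -/
theorem homogeneous_or_exceptional {p : ℕ} [Fact p.Prime] {T : Set (AddSubgroup (Grp p 2))}
    (hT : T ⊆ Delta (Grp p 2)) (hbot : ⊥ ∉ T) (hS : IsSRCG (connSet T))
    (hnt : ¬ IsTrivial (connSet T)) :
    (∃ a₁ a₂ : ℕ, IsHomogeneous p 2 ![a₁, a₂] T) ∨
      (p = 2 ∧ ((∃ J, J ∈ sons p (⊥ : AddSubgroup (Grp p 2)) ∧ J ∉ T ∧ (sons p J ∩ T).ncard = p ∧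
          ∀ H ∈ sons p (⊥ : AddSubgroup (Grp p 2)), H ≠ J → H ∈ T ∧ (sons p H ∩ T).ncard = 1) ∨
        (∃ J, J ∈ sons p (⊥ : AddSubgroup (Grp p 2)) ∧ J ∈ T ∧ (sons p J ∩ T).ncard = 0 ∧
          ∀ H ∈ sons p (⊥ : AddSubgroup (Grp p 2)), H ≠ J →
            H ∉ T ∧ (sons p H ∩ T).ncard = 1))) := by
  classical
  have hcases := classification_connSet hT hbot hS rfl rfl
  have hp := (Fact.out : p.Prime).pos
  have ht1 : ∀ H : AddSubgroup (Grp p 2), (if H ∈ T then (1 : ℤ) else 0) = 1 ↔ H ∈ T := by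
    intro H; by_cases h : H ∈ T <;> simp [h]
  have ht0 : ∀ H : AddSubgroup (Grp p 2), (if H ∈ T then (1 : ℤ) else 0) = 0 ↔ H ∉ T := by
    intro H; by_cases h : H ∈ T <;> simp [h]
  have hs0 : ∀ H : AddSubgroup (Grp p 2), ((sons p H ∩ T).ncard : ℤ) = 0 →
      ∀ F ∈ sons p H, F ∉ T :=
    fun H h F hF => notMem_of_ncard_eq_zero (by exact_mod_cast h) hF
  have hsp : ∀ H ∈ sons p (⊥ : AddSubgroup (Grp p 2)), ((sons p H ∩ T).ncard : ℤ) = p →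
      ∀ F ∈ sons p H, F ∉ Tᶜ := by
    intro H hH h F hF
    have := ncard_sons_inter_add hH T
    exact notMem_of_ncard_eq_zero (by omega) hF
  simp only [ht1, ht0, Subtype.forall, Subtype.exists, Subtype.mk.injEq, ne_eq] at hcases
  -- The last six patterns describe a subgroup of order `p`, the full `p`-torsion, or the preimage
  -- of a subgroup of order `p` under multiplication by `p`, each followed by its complement.
  rcases hcases with ⟨b, hb0, hbp, h⟩ | ⟨hp2, J, hJ, ⟨h1, h2⟩, h3⟩ | ⟨hp2, J, hJ, ⟨h1, h2⟩, h3⟩ |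
    ⟨h1, J, hJ, h2, h3⟩ | ⟨h1, J, hJ, h2, h3⟩ | ⟨h1, h2⟩ | ⟨h1, h2⟩ | ⟨h1, J, hJ, h2, h3⟩ |
    ⟨h1, J, hJ, h2, h3⟩
  · left
    refine ⟨_, b.toNat, isHomogeneous_iff.2 ⟨⟨?_, by omega⟩, hT, hbot, rfl, fun H hH => ?_⟩⟩
    · rw [← ncard_sons_bot (p := p)]
      exact Set.ncard_le_ncard Set.inter_subset_left
    · have := h H hH
      split_ifs at this ⊢ <;> omega
  · have hp2' : p = 2 := by exact_mod_cast hp2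
    refine Or.inr ⟨hp2', Or.inl ⟨J, hJ, h1, by omega, fun H hH hHJ => ?_⟩⟩
    have := h3 H hH hHJ
    exact ⟨this.1, by exact_mod_cast this.2⟩
  · have hp2' : p = 2 := by exact_mod_cast hp2
    refine Or.inr ⟨hp2', Or.inr ⟨J, hJ, h1, by exact_mod_cast h2, fun H hH hHJ => ?_⟩⟩
    have := h3 H hH hHJ
    exact ⟨this.1, by exact_mod_cast this.2⟩
  · refine absurd (isSubgroupLike_line hJ (fun H hH => ?_) fun H hH => hs0 H (h1 H hH)).isTrivial hnt
    exact ⟨fun hHT => by_contra fun hHJ => h3 H hH hHJ hHT, fun h => h ▸ h2⟩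
  · refine absurd ((isSubgroupLike_line hJ (fun H hH => ?_)
      fun H hH => hsp H hH (h1 H hH)).isTrivial_of_compl hbot) hnt
    exact ⟨fun hHT => by_contra fun hHJ => hHT (h3 H hH hHJ), fun h => h ▸ h2⟩
  · exact absurd (isSubgroupLike_torsion h2 fun H hH => hs0 H (h1 H hH)).isTrivial hnt
  · exact absurd ((isSubgroupLike_torsion (T := Tᶜ) h2
      fun H hH => hsp H hH (h1 H hH)).isTrivial_of_compl hbot) hnt
  · refine absurd (isSubgroupLike_comap hJ h1 fun H hH F hF => ?_).isTrivial hnt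
    refine ⟨fun hFT => by_contra fun hHJ => hs0 H (h3 H hH hHJ) F hF hFT, fun h => ?_⟩
    exact not_not.1 (hsp H hH (h ▸ h2) F hF)
  · refine absurd ((isSubgroupLike_comap (T := Tᶜ) hJ h1 fun H hH F hF => ?_).isTrivial_of_compl
      hbot) hnt
    refine ⟨fun hFT => by_contra fun hHJ => hsp H hH (h3 H hH hHJ) F hF hFT, fun h => ?_⟩
    exact hs0 H (h ▸ h2) F hF

lemma exists_connSet_eq {p : ℕ} [Fact p.Prime] {S : Set (Grp p 2)} (hS : IsSRCG S)
    (hnt : ¬ IsTrivial S) :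
    ∃ T : Set (AddSubgroup (Grp p 2)), T ⊆ Delta (Grp p 2) ∧ ⊥ ∉ T ∧ connSet T = S := by
  have hcard : Fintype.card (Grp p 2) = (p ^ 2) ^ 2 := by
    rw [← Nat.card_eq_fintype_card, Nat.card_prod, Nat.card_zmod, ← pow_two]
  refine ⟨zmultiples '' S, ?_, ?_, connSet_image_zmultiples hS.1 fun t ht x hx =>
    nsmul_mem_of_int_charSum (pow_pos (Fact.out : p.Prime).pos 2) grp_exp
      (exists_int_charSum hS hnt hcard) ht hx⟩
  · rintro _ ⟨x, _, rfl⟩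
    exact zmultiples_mem_delta x
  · rintro ⟨x, hx, h⟩
    rw [zmultiples_eq_bot] at h
    exact hS.1 (h ▸ hx)

lemma subset_of_ncard_sons_inter {p : ℕ} [Fact p.Prime] {T : Set (AddSubgroup (Grp p 2))}
    {J : AddSubgroup (Grp p 2)} (hJ : J ∈ sons p (⊥ : AddSubgroup (Grp p 2)))
    (h : (sons p J ∩ T).ncard = p) : sons p J ⊆ T := by
  have h1 := Set.eq_of_subset_of_ncard_le (Set.inter_subset_left (s := sons p J) (t := T))
    (by rw [h, ncard_sons hJ])
  exact Set.inter_eq_left.1 h1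

end Main

end SRCG

theorem corollary7p1 (p : ℕ) [Fact p.Prime] (S : Set (SRCG.Grp p 2))
    (hS : SRCG.IsSRCG S) (hnontriv : ¬ SRCG.IsTrivial S) :
    Xor
      (∃ a₁ a₂ : ℕ, (a₁, a₂) ∉ ({(1, 0), (p, p - 1), (0, 0), (p + 1, p - 1)} : Set (ℕ × ℕ)) ∧
        ∃ T : Set (AddSubgroup (SRCG.Grp p 2)),
          SRCG.IsHomogeneous p 2 ![a₁, a₂] T ∧ SimpleGraph.addCayley S = SRCG.graphOf T)
      (p = 2 ∧
        ((SimpleGraph.addCayley S ∈ SRCG.Gamma2c p ∧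
            Nonempty (SimpleGraph.addCayley S ≃g SRCG.clebsch)) ∨
          (SimpleGraph.addCayley S ∈ SRCG.Gamma2 p ∧
            Nonempty (SimpleGraph.addCayley S ≃g SRCG.clebschᶜ)))) := by
  obtain ⟨T, hT, hbot, rfl⟩ := SRCG.exists_connSet_eq hS hnontriv
  rcases SRCG.homogeneous_or_exceptional hT hbot hS hnontriv with ⟨a₁, a₂, h⟩ | ⟨rfl, h⟩
  · refine Or.inl ⟨⟨a₁, a₂, fun ha => hnontriv (SRCG.isTrivial_of_homogeneous h ha), T, h, rfl⟩, ?_⟩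
    rintro ⟨rfl, h2⟩
    exact SRCG.not_homogeneous_of_iso (h2.imp And.right And.right) h rfl
  · suffices h2 : (SimpleGraph.addCayley (SRCG.connSet T) ∈ SRCG.Gamma2c 2 ∧
        Nonempty (SimpleGraph.addCayley (SRCG.connSet T) ≃g SRCG.clebsch)) ∨
        (SimpleGraph.addCayley (SRCG.connSet T) ∈ SRCG.Gamma2 2 ∧
        Nonempty (SimpleGraph.addCayley (SRCG.connSet T) ≃g SRCG.clebschᶜ)) by
      refine Or.inr ⟨⟨rfl, h2⟩, ?_⟩
      rintro ⟨a₁, a₂, -, T', hT', hST⟩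
      exact SRCG.not_homogeneous_of_iso (h2.imp And.right And.right) hT' hST
    change (SRCG.graphOf T ∈ SRCG.Gamma2c 2 ∧ Nonempty (SRCG.graphOf T ≃g SRCG.clebsch)) ∨
      (SRCG.graphOf T ∈ SRCG.Gamma2 2 ∧ Nonempty (SRCG.graphOf T ≃g SRCG.clebschᶜ))
    rcases h with ⟨J, hJ, hJT, hJs, hJo⟩ | ⟨J, hJ, hJT, hJs, hJo⟩
    · right
      have hE : SRCG.IsExceptional T J := ⟨hT, hbot, hJ, hJT,
        SRCG.subset_of_ncard_sons_inter hJ hJs, fun H hH hne => (hJo H hH hne).1,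
        fun H hH hne => (hJo H hH hne).2⟩
      obtain ⟨e⟩ := hE.nonempty_iso
      refine ⟨hE.graphOf_mem, ⟨?_⟩⟩
      have e' := SRCG.isoCompl e
      rwa [compl_compl] at e'
    · left
      have hcount : ∀ H ∈ SRCG.sons 2 (⊥ : AddSubgroup (SRCG.Grp 2 2)),
          (SRCG.sons 2 H ∩ T).ncard + (SRCG.sons 2 H ∩ SRCG.complSet T).ncard = 2 := by
        intro H hH
        rw [SRCG.sons_inter_complSet]
        exact SRCG.ncard_sons_inter_add hH T
      -- The second exceptional pattern is the complement of the first: in each node, membership is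
      -- reversed and the number of sons `s` becomes `2 - s`.
      have hE : SRCG.IsExceptional (SRCG.complSet T) J := by
        refine ⟨fun H hH => hH.1.1, fun h => h.1.2 rfl, hJ, fun h => h.2 hJT,
          SRCG.subset_of_ncard_sons_inter hJ ?_,
          fun H hH hne => ⟨⟨hH.1, hH.2.1⟩, (hJo H hH hne).1⟩, fun H hH hne => ?_⟩
        · have := hcount J hJ
          omega
        · have := hcount H hH
          have := (hJo H hH hne).2
          omega
      have hmem := hE.graphOf_mem
      obtain ⟨e⟩ := hE.nonempty_iso
      rw [SRCG.graphOf_complSet hbot] at hmem e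
      rw [compl_compl] at e
      exact ⟨hmem, ⟨e⟩⟩
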